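/- Let $0<c<a\le+\infty$, $c_1=-c$, $c_2=c$, and let $F$ be an odd map of $I=(-a,a)$ which is continuous and strictly decreasing on each of $(-a,c_1)$, $(c_1,c_2)$, $(c_2,a)$, maps these intervals into $I$, and satisfies $\lim_{x\to c_i^{\pm}}F(x)=\pm a$ ($i=1,2$) and $\lim_{x\to\pm a}F(x)=\pm b$ with $b\in\mathbb R$ (an odd discontinuous bimodal map). Put $F(c_1)=F(c_1^-)=-a$, $F(c_2)=F(c_2^+)=a$ and $F(\pm a)=\pm b$. The itinerary of $x\in[-a,a]$ is the sequence of addresses of $x,F(x),F^2(x),\dots$, where the address of $y$ is $L,A,M,B,R$ according as $y<c_1$, $y=c_1$, $c_1<y<c_2$, $y=c_2$, $y>c_2$. Suppose that the kneading sequence (the itinerary of $a$) is periodic of period $p$, in the sense that $c_2$ is a periodic point of $F$ of least period $p$; that is, the kneading sequence is $(S_1\cdots S_p)^\infty$ with $S_p=B$ and $S_k\ne B$ for $1\le k<p$. Kneading determinant: let $c_1^-,c_1^+,c_2^-,c_2^+$ have the itineraries $L\,\mathrm{It}(-a)$, $M\,\mathrm{It}(a)$, $M\,\mathrm{It}(-a)$,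 $R\,\mathrm{It}(a)$. For a word $X_0X_1\dots$ put $\theta(t)=\sum_{k\ge0}(-1)^kX_kt^k$, a formal power series with coefficients in the vector space with basis $L,M,R$, where $A$ is read as $L$ and $B$ as $R$. Let $N$ be the $2\times3$ matrix whose $i$-th row holds the coordinates, with respect to $L,M,R$, of $\theta_{c_i^+}-\theta_{c_i^-}$, let $D_j$ be the minor of $N$ that omits column $j$, and let $D(t)=(-1)^{j+1}D_j/(1+t)$ for any $j\in\{1,2,3\}$. The power series $D$ is regarded as a function on $[0,1)$, and $D(1)$ means $\lim_{t\to1^-}D(t)$ where this limit exists. Markov matrix: let $z_1<z_2<\dots<z_m$ be the distinct points among $F^k(c_1)$, $F^k(c_2)$, $0\le k<p$, let $I_k=(z_k,z_{k+1})$ for $1\le k<m$, and let $\Psi=(\psi_{ij})$ be the $(m-1)\times(m-1)$ matrix with $\psi_{ij}=1$ if $I_j\subseteq F(I_i)$ and $\psi_{ij}=0$ otherwise. Then $D$ has a least root $t_0$ in the unit interval $(0,1]$, and the spectral radius of $\Psi$ equals $1/t_0$. Moreover, if the orbit of $a$ does not contain $-a$ (so that $m=2p$), then $$\bigl(1-(-1)^pt^p\bigr)^2D(t)=\det(I-t\Psi).$$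 -/

import Mathlib

open Set Filter Topology

noncomputable section

/-- A symmetric (odd) bimodal discontinuous map of type `(-,-,-)` on `I = (-a, a)`, where
`a` may be `+∞`, with discontinuities `c₁ = -c` and `c₂ = c`. The map is recorded together with
its conventional values `F(c₁) = F(c₁⁻) = -a`, `F(c₂) = F(c₂⁺) = a`, `F(±a) = ±b` at the
discontinuities and at the end points, hence as a map on `[-a, a] ⊆ [-∞, ∞]`. Its values
outside `[-a, a]` are irrelevant. -/
structure OddBimodalMap where
  /-- the right end point of the interval -/
  a : EReal
  /-- the right discontinuity `c₂`; the left one is `c₁ = -c₂` -/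
  c : EReal
  /-- the limit of the map at the right end point -/
  b : ℝ
  /-- the map -/
  toFun : EReal → EReal
  c_pos : 0 < c
  c_lt_a : c < a
  /-- `F` maps the points of continuity of `I` into `I` -/
  mapsTo : ∀ x ∈ Ioo (-a) a, x ≠ -c → x ≠ c → toFun x ∈ Ioo (-a) a
  odd : ∀ x ∈ Icc (-a) a, toFun (-x) = -toFun x
  continuousOn_left : ContinuousOn toFun (Ioo (-a) (-c))
  continuousOn_mid : ContinuousOn toFun (Ioo (-c) c)
  continuousOn_right : ContinuousOn toFun (Ioo c a)
  anti_left : StrictAntiOn toFun (Ioo (-a) (-c))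
  anti_mid : StrictAntiOn toFun (Ioo (-c) c)
  anti_right : StrictAntiOn toFun (Ioo c a)
  tendsto_c1_left : Tendsto toFun (𝓝[<] (-c)) (𝓝 (-a))
  tendsto_c1_right : Tendsto toFun (𝓝[>] (-c)) (𝓝 a)
  tendsto_c2_left : Tendsto toFun (𝓝[<] c) (𝓝 (-a))
  tendsto_c2_right : Tendsto toFun (𝓝[>] c) (𝓝 a)
  tendsto_a : Tendsto toFun (𝓝[<] a) (𝓝 (b : EReal))
  tendsto_neg_a : Tendsto toFun (𝓝[>] (-a)) (𝓝 (-(b : EReal)))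
  map_c1 : toFun (-c) = -a
  map_c2 : toFun c = a
  map_a : toFun a = (b : EReal)
  map_neg_a : toFun (-a) = -(b : EReal)

/-- The alphabet `{L, A, M, B, R}`. -/
inductive KSymbol where
  | L | A | M | B | R

namespace KSymbol

/-- The coordinates of a symbol in the space with basis `L, M, R` (indexed by `0, 1, 2`).
In accordance with `F(c₁) = F(c₁⁻)` and `F(c₂) = F(c₂⁺)`, the symbol `A` of `c₁` counts as `L`
and the symbol `B` of `c₂` counts as `R`. -/
def coord : KSymbol → Fin 3 → ℝ
  | L => ![1, 0, 0]
  | A => ![1, 0, 0]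
  | M => ![0, 1, 0]
  | B => ![0, 0, 1]
  | R => ![0, 0, 1]

end KSymbol

namespace OddBimodalMap

/-- The address of a point. -/
def address (F : OddBimodalMap) (x : EReal) : KSymbol :=
  if x < -F.c then KSymbol.L
  else if x = -F.c then KSymbol.A
  else if x < F.c then KSymbol.M
  else if x = F.c then KSymbol.B
  else KSymbol.R

/-- The symbolic itinerary of a point. -/
def itinerary (F : OddBimodalMap) (x : EReal) (n : ℕ) : KSymbol :=
  F.address (F.toFun^[n] x)

/-- The infinite word `s X₀ X₁ X₂ …`. -/
def consWord (s : KSymbol) (X : ℕ → KSymbol) : ℕ → KSymbol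
  | 0 => s
  | n + 1 => X n

/-- The itineraries of `c₁⁻` and `c₂⁻` (rows `0` and `1`): the symbol of the lap to the left of
the discontinuity, followed by the itinerary of `F(c_i⁻) = -a`. -/
def itineraryLeft (F : OddBimodalMap) (i : Fin 2) : ℕ → KSymbol :=
  consWord (![KSymbol.L, KSymbol.M] i) (F.itinerary (-F.a))

/-- The itineraries of `c₁⁺` and `c₂⁺` (rows `0` and `1`): the symbol of the lap to the right of
the discontinuity, followed by the itinerary of `F(c_i⁺) = a`. -/
def itineraryRight (F : OddBimodalMap) (i : Fin 2) : ℕ → KSymbol :=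
  consWord (![KSymbol.M, KSymbol.R] i) (F.itinerary F.a)

/-- The invariant coordinate `∑ (-1)^k X_k t^k` of a word, collected by the symbols
`L, M, R`. -/
def invariantCoord (X : ℕ → KSymbol) (j : Fin 3) : PowerSeries ℝ :=
  PowerSeries.mk fun k => (-1) ^ k * (X k).coord j

/-- The kneading matrix; row `i` holds the coordinates of the kneading increment
`θ_{c_i⁺} - θ_{c_i⁻}`. -/
def kneadingMatrix (F : OddBimodalMap) : Matrix (Fin 2) (Fin 3) (PowerSeries ℝ) :=
  Matrix.of fun i j =>
    invariantCoord (F.itineraryRight i) j - invariantCoord (F.itineraryLeft i) j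

/-- The kneading determinant `± D_j / (1 + t)`, where `D_j` is the minor of the kneading matrix
that omits column `j`. Columns are numbered from `0`, so that the sign is `(-1)^j`. -/
def kneadingDet (F : OddBimodalMap) (j : Fin 3) : PowerSeries ℝ :=
  (-1) ^ (j : ℕ) * (F.kneadingMatrix.submatrix id j.succAbove).det * (1 + PowerSeries.X)⁻¹

/-- The discontinuity `c₂` (hence also `c₁`) is a periodic point of least period `p`.
Equivalently, the kneading sequence, the itinerary of `a`, is `(S₁ … S_p)^∞` where the symbol
`B` occurs in `S₁ … S_p` as `S_p` only. -/
def IsPeriodicKneading (F : OddBimodalMap) (p : ℕ) : Prop :=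
  0 < p ∧ Function.minimalPeriod F.toFun F.c = p

/-- The orbit of `a` contains `-a`. -/
def IsBistable (F : OddBimodalMap) : Prop :=
  ∃ k : ℕ, F.toFun^[k] F.a = -F.a

/-- The points of the orbits of `c₂` and `c₁` up to time `p - 1`. -/
def markovPoints (F : OddBimodalMap) (p : ℕ) : Finset EReal :=
  (Finset.range p).image (fun k => F.toFun^[k] F.c) ∪
    (Finset.range p).image (fun k => F.toFun^[k] (-F.c))

/-- The number of intervals of the Markov partition. -/
def numIntervals (F : OddBimodalMap) (p : ℕ) : ℕ := (F.markovPoints p).card - 1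

/-- The points `z_0 < z_1 < …` of the partition in increasing order. -/
def markovPoint (F : OddBimodalMap) (p : ℕ) (k : Fin (F.markovPoints p).card) : EReal :=
  (F.markovPoints p).orderEmbOfFin rfl k

/-- The interval `I_k` between two consecutive points of the partition. -/
def markovInterval (F : OddBimodalMap) (p : ℕ) (k : Fin (F.numIntervals p)) : Set EReal :=
  Ioo (F.markovPoint p ⟨k, by have := k.2; unfold numIntervals at this; omega⟩)
    (F.markovPoint p ⟨k + 1, by have := k.2; unfold numIntervals at this; omega⟩)

open Classical in
/-- The Markov transition matrix: the entry is `1` if `I_j ⊆ F(I_i)`, and `0` otherwise. -/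
def markovMatrix (F : OddBimodalMap) (p : ℕ) :
    Matrix (Fin (F.numIntervals p)) (Fin (F.numIntervals p)) ℝ :=
  Matrix.of fun i j =>
    if F.markovInterval p j ⊆ F.toFun '' F.markovInterval p i then 1 else 0

end OddBimodalMap

/-- `t ∈ (0, 1]` is a root of the function defined by the power series `D` on `[0, 1)`, which is
given its limit value at `t = 1`. -/
def IsUnitIntervalRoot (D : PowerSeries ℝ) (t : ℝ) : Prop :=
  0 < t ∧ t ≤ 1 ∧ (∀ s ∈ Ico (0 : ℝ) t, Summable fun k : ℕ => PowerSeries.coeff k D * s ^ k) ∧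
    Tendsto (fun s : ℝ => ∑' k : ℕ, PowerSeries.coeff k D * s ^ k) (𝓝[<] t) (𝓝 0)

end

/-! Let δ be the side of a partition point (-1, 0, 1 for L, M, R), σ the map induced by F on the
points z_0 < … < z_n, C the operator g ↦ g ∘ σ, and Δ the difference operator. Since F decreases on
each lap, the image of an interval has the images of its ends as reversed end points, except that at
a discontinuity -a and a are exchanged. Hence ΨΔg = (g_n - g_0)Δδ - Δ(g ∘ σ)
(`IsMarkovPartition.sum_transitionMatrix`). So T = C - δwᵀ, with wᵀg = g_n - g_0, fixes constants
and acts on differences as -Ψ, and det(1 + tT) = (1 + t) det(1 - tΨ). If y = δ - t(y ∘ σ), the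
matrix determinant lemma gives det(1 + tT) = det(1 + tC) · N with N = 1 - t(y_n - y_0). Oddness
identifies N with (1 + t)D (`kneadingDet_mul`), so det(1 - tΨ) = det(1 + tC) D. Two disjoint
p-cycles give det(1 + tC) = (1 - (-t)^p)².

For the least root, (1 - tΨ)Δy = NΔδ yields N(1 + t∑ A_k t^k) = 1, where A_k is the sum of the
entries of Ψ^kΔδ and A_k ≥ 2. This excludes zeros of N below 1/ρ, with ρ the spectral radius, and
forces ρ ≥ 1. If ρ > 1, an eigenvalue of modulus ρ gives a zero of N on the circle |z| = 1/ρ,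
because det(1 + zC) ≠ 0 in the unit disc; A_k ≥ 0 moves it to 1/ρ as in Pringsheim's theorem. If ρ =
1, A_k ≥ 1 forces D(t) → 0 as t → 1⁻. -/

/-! ### Determinant identities for an abstract transition matrix -/

/-- The determinant of a matrix whose first column vanishes below the diagonal. -/
theorem Matrix.det_eq_mul_det_submatrix_succ {R : Type*} [CommRing R] {n : ℕ}
    (Z : Matrix (Fin (n + 1)) (Fin (n + 1)) R) (h : ∀ i : Fin n, Z i.succ 0 = 0) :
    Z.det = Z 0 0 * (Z.submatrix Fin.succ Fin.succ).det := by
  rw [Matrix.det_succ_column_zero, Fin.sum_univ_succ]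
  simp [h, Fin.succAbove_zero]

/-- If `T` fixes constants and acts on differences through `-Ψ`, then
`det (1 + x T) = (1 + x) det (1 - x Ψ)`. -/
theorem Matrix.det_one_add_smul_of_differences {R : Type*} [CommRing R] {n : ℕ}
    (T : Matrix (Fin (n + 1)) (Fin (n + 1)) R) (Ψ : Matrix (Fin n) (Fin n) R)
    (h1 : T.mulVec 1 = 1)
    (hd : ∀ (g : Fin (n + 1) → R) (i : Fin n), T.mulVec g i.succ - T.mulVec g i.castSucc =
      -∑ j, Ψ i j * (g j.succ - g j.castSucc)) (x : R) :
    (1 + x • T).det = (1 + x) * (1 - x • Ψ).det := by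
  -- `B` sends g to (g_0, Δg) and `S` is its inverse, summation. In these coordinates `T` is block
  -- triangular with diagonal blocks 1 and `-Ψ`.
  let B : Matrix (Fin (n + 1)) (Fin (n + 1)) R :=
    Matrix.of (Fin.cons (Pi.single 0 1) fun i => Pi.single i.succ 1 - Pi.single i.castSucc 1)
  let S : Matrix (Fin (n + 1)) (Fin (n + 1)) R :=
    Matrix.of fun i => Fin.cons 1 fun j => if j.castSucc < i then 1 else 0
  have hBrow : ∀ (M : Matrix (Fin (n + 1)) (Fin (n + 1)) R) (i : Fin n) (k),
      (B * M) i.succ k = M i.succ k - M i.castSucc k := by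
    intro M i k
    simp [B, Matrix.mul_apply, sub_mul, Finset.sum_sub_distrib, Pi.single_apply]
  have hBrow0 : ∀ (M : Matrix (Fin (n + 1)) (Fin (n + 1)) R) (k), (B * M) 0 k = M 0 k := by
    intro M k
    simp [B, Matrix.mul_apply, Pi.single_apply]
  have hSsub : ∀ (i j : Fin n), S i.succ j.succ - S i.castSucc j.succ = if i = j then 1 else 0 := by
    intro i j
    simp only [S, Matrix.of_apply, Fin.cons_succ]
    simp only [Fin.lt_def, Fin.val_castSucc, Fin.val_succ, Fin.ext_iff]
    grind
  have hS0 : ∀ i, S i 0 = 1 := fun i => by simp [S]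
  have hBS : B * S = 1 := by
    ext i k
    refine Fin.cases ?_ (fun i => ?_) i
    · rw [hBrow0]
      refine Fin.cases ?_ (fun j => ?_) k
      · simp [S]
      · simp [S, (Fin.succ_ne_zero j).symm]
    · rw [hBrow]
      refine Fin.cases ?_ (fun j => ?_) k
      · simp [S]
      · rw [hSsub]; simp [Matrix.one_apply]
  have hdet : (1 + x • T).det = (B * (1 + x • T) * S).det := by
    have : B.det * S.det = 1 := by rw [← Matrix.det_mul, hBS, Matrix.det_one]
    rw [Matrix.det_mul, Matrix.det_mul, mul_right_comm, this, one_mul]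
  have hZ : B * (1 + x • T) * S = 1 + x • (B * (T * S)) := by
    rw [mul_add, mul_one, add_mul, hBS, mul_smul_comm, smul_mul_assoc, mul_assoc]
  have hTS0 : ∀ i, (T * S) i 0 = 1 := by
    intro i
    have := congrFun h1 i
    simp only [Matrix.mulVec, dotProduct, Pi.one_apply] at this
    simpa [Matrix.mul_apply, hS0] using this
  have hTS : ∀ i j : Fin n, (B * (T * S)) i.succ j.succ = -Ψ i j := by
    intro i j
    have := hd (fun k => S k j.succ) i
    simp only [hSsub, Matrix.mulVec, dotProduct, mul_ite, mul_one, mul_zero, Finset.sum_ite_eq',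
      Finset.mem_univ, if_true] at this
    rw [hBrow, ← this]
    simp [Matrix.mul_apply]
  rw [hdet, hZ, Matrix.det_eq_mul_det_submatrix_succ]
  · congr 1
    · simp [hBrow0, hTS0]
    · congr 1
      ext i j
      simp [hTS, Matrix.one_apply, sub_eq_add_neg]
  · intro i
    simp [hBrow, hTS0, Fin.succ_ne_zero]

/-- The matrix of the composition operator `g ↦ g ∘ σ`. -/
def compMatrix {ι : Type*} [DecidableEq ι] (R : Type*) [Zero R] [One R] (σ : ι → ι) :
    Matrix ι ι R :=
  Matrix.of fun i k => if k = σ i then 1 else 0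

theorem compMatrix_mulVec {ι R : Type*} [DecidableEq ι] [Fintype ι] [CommRing R] (σ : ι → ι)
    (g : ι → R) : (compMatrix R σ).mulVec g = g ∘ σ := by
  ext i
  simp [compMatrix, Matrix.mulVec, dotProduct]

/-- The determinant identity behind the kneading determinant: `σ` is a map of the `n + 1` points
of a partition, `δ` the addresses of the points, and `Ψ` the transition matrix of the `n`
intervals of the partition. -/
theorem det_transition_eq {R : Type*} [CommRing R] {n : ℕ} (σ : Fin (n + 1) → Fin (n + 1))
    (δ : Fin (n + 1) → R) (Ψ : Matrix (Fin n) (Fin n) R)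
    (hΨ : ∀ (g : Fin (n + 1) → R) (i : Fin n), ∑ j, Ψ i j * (g j.succ - g j.castSucc) =
      (g (Fin.last n) - g 0) * (δ i.succ - δ i.castSucc) - (g (σ i.succ) - g (σ i.castSucc)))
    (x : R) (y : Fin (n + 1) → R) (hy : ∀ i, y i = δ i - x * y (σ i)) :
    (1 + x) * (1 - x • Ψ).det =
      (1 + x • compMatrix R σ).det * (1 - x * (y (Fin.last n) - y 0)) := by
  let w : Fin (n + 1) → R := Pi.single (Fin.last n) 1 - Pi.single 0 1
  have hw : ∀ g : Fin (n + 1) → R, w ⬝ᵥ g = g (Fin.last n) - g 0 := by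
    intro g; simp [w, sub_dotProduct]
  have hT : ∀ (g : Fin (n + 1) → R) i,
      (compMatrix R σ - Matrix.vecMulVec δ w).mulVec g i =
        g (σ i) - δ i * (g (Fin.last n) - g 0) := by
    intro g i
    rw [Matrix.sub_mulVec, compMatrix_mulVec, Matrix.vecMulVec_mulVec, hw]
    simp
  rw [← Matrix.det_one_add_smul_of_differences (compMatrix R σ - Matrix.vecMulVec δ w) Ψ]
  · have hyδ : (1 + x • compMatrix R σ).mulVec y = δ := by
      ext i
      rw [Matrix.add_mulVec, Matrix.smul_mulVec, compMatrix_mulVec]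
      simp [hy i]
    -- Since (1 + xC)y = δ, the factor 1 + xC splits off on the left without being inverted; what
    -- remains is a rank one perturbation of 1.
    have : 1 + x • (compMatrix R σ - Matrix.vecMulVec δ w) =
        (1 + x • compMatrix R σ) * (1 + Matrix.replicateCol Unit (-x • y) *
          Matrix.replicateRow Unit w) := by
      rw [mul_add, mul_one, ← Matrix.vecMulVec_eq, Matrix.mul_vecMulVec, Matrix.mulVec_smul, hyδ,
        Matrix.smul_vecMulVec, smul_sub, neg_smul]
      abel
    rw [this, Matrix.det_mul, Matrix.det_one_add_replicateCol_mul_replicateRow, dotProduct_smul, hw]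
    congr 1
    simp [sub_eq_add_neg]
  · ext i; simp [hT]
  · intro g i
    rw [hT, hT, hΨ]
    ring

/-- If `(1 - x Ψ) v = dδ`, then `N (1 + x ∑ v) = 1` for `N = 1 - x (y_n - y_0)`. -/
theorem kneading_mul_eq_one {R : Type*} [CommRing R] {n : ℕ} (σ : Fin (n + 1) → Fin (n + 1))
    (δ : Fin (n + 1) → R) (Ψ : Matrix (Fin n) (Fin n) R)
    (hΨ : ∀ (g : Fin (n + 1) → R) (i : Fin n), ∑ j, Ψ i j * (g j.succ - g j.castSucc) =
      (g (Fin.last n) - g 0) * (δ i.succ - δ i.castSucc) - (g (σ i.succ) - g (σ i.castSucc)))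
    (x : R) (y : Fin (n + 1) → R) (hy : ∀ i, y i = δ i - x * y (σ i))
    (G : Matrix (Fin n) (Fin n) R) (hG : G * (1 - x • Ψ) = 1) :
    (1 - x * (y (Fin.last n) - y 0)) *
      (1 + x * ∑ i, G.mulVec (fun i => δ i.succ - δ i.castSucc) i) = 1 := by
  set N := 1 - x * (y (Fin.last n) - y 0) with hN
  let η : Fin n → R := fun i => δ i.succ - δ i.castSucc
  -- The terms in y ∘ σ from `hΨ` cancel those from the recursion `hy`.
  have h1 : (1 - x • Ψ).mulVec (fun i => y i.succ - y i.castSucc) = N • η := by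
    ext i
    rw [Matrix.sub_mulVec, Matrix.smul_mulVec]
    simp only [Matrix.one_mulVec, Pi.sub_apply, Pi.smul_apply, smul_eq_mul]
    rw [Matrix.mulVec, dotProduct, hΨ, hN, hy i.succ, hy i.castSucc]
    simp only [η]
    ring
  have h2 : (fun i => y i.succ - y i.castSucc) = N • G.mulVec η := by
    rw [← Matrix.mulVec_smul, ← h1, Matrix.mulVec_mulVec, hG, Matrix.one_mulVec]
  have h3 : ∑ i : Fin n, (y i.succ - y i.castSucc) = N * ∑ i, G.mulVec η i := by
    rw [Finset.mul_sum]
    exact Finset.sum_congr rfl fun i _ => congrFun h2 i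
  rw [Finset.sum_sub_distrib, ← add_sub_add_left_eq_sub _ _ (y 0), ← Fin.sum_univ_succ,
    add_comm (y 0), Fin.sum_univ_castSucc] at h3
  have h4 : y (Fin.last n) - y 0 = N * ∑ i, G.mulVec η i := by
    rw [← h3]; abel
  change N * (1 + x * ∑ i, G.mulVec η i) = 1
  rw [mul_add, mul_one, mul_left_comm, ← h4, hN]
  ring

/-- The determinant of `1 + x C` for a cyclic permutation matrix `C`. -/
theorem det_one_add_smul_cycle {R : Type*} [CommRing R] (q : ℕ) (x : R) :
    (1 + x • compMatrix R (fun i : Fin (q + 1) => i + 1)).det = 1 - (-x) ^ (q + 1) := by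
  let V := 1 + x • compMatrix R (fun i : Fin (q + 1) => i + 1)
  -- Column operations that clear the corner entry: the first column of `V * E` is (1 - (-x)^(q+1),
  -- 0, …, 0), and the rest is upper triangular with diagonal 1.
  let E : Matrix (Fin (q + 1)) (Fin (q + 1)) R :=
    Matrix.of fun i k => if k = 0 then (if i = 0 then 1 else (-x) ^ (q + 1 - i))
      else if i = k then 1 else 0
  have hE : E.det = 1 := by
    rw [Matrix.det_of_isLowerTriangular]
    · refine Finset.prod_eq_one fun i _ => ?_
      by_cases h : i = 0 <;> simp [E, h]
    · intro i k h
      have h' : i < k := h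
      have : k ≠ 0 := fun h0 => by simp [h0] at h'
      simp [E, this, h'.ne]
  have hVE : ∀ i k, (V * E) i k = E i k + x * E (i + 1) k := by
    intro i k
    simp [V, add_mul, compMatrix, Matrix.mul_apply, Finset.sum_add_distrib, Matrix.one_apply]
  have hlast : (V * E).det = 1 - (-x) ^ (q + 1) := by
    rw [Matrix.det_of_isUpperTriangular, Fin.prod_univ_succ]
    · rw [Finset.prod_eq_one, mul_one, hVE]
      · rcases q with - | q
        · simp [E]
        · simp only [E, Matrix.of_apply, if_true, zero_add, one_ne_zero, if_false]
          simp only [Fin.val_one]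
          rw [pow_succ]
          simp
          ring
      · intro i _
        rw [hVE]
        have : i.succ + 1 ≠ i.succ := by
          rcases q with - | q
          · exact i.elim0
          · simp
        simp [E, this, Fin.succ_ne_zero]
    · intro i k h
      have h' : k < i := h
      have hi : i ≠ 0 := fun h0 => by simp [h0] at h'
      rw [hVE]
      rcases eq_or_ne i (Fin.last q) with rfl | hl
      · by_cases hk : k = 0
        · subst hk
          simp [E, hi]
        · simp [E, hk, h'.ne', Ne.symm hk]
      · have hv : ((i + 1 : Fin (q + 1)) : ℕ) = i + 1 := Fin.val_add_one_of_lt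
          (lt_of_le_of_ne (Fin.le_last i) hl)
        have hi1 : i + 1 ≠ 0 := fun h0 => by simp [h0] at hv
        by_cases hk : k = 0
        · subst hk
          simp only [E, Matrix.of_apply, if_true, hi, hi1, if_false, hv]
          have : q + 1 - (i : ℕ) = (q + 1 - (i + 1)) + 1 := by
            have := i.2; omega
          rw [this, pow_succ]
          ring
        · have : i + 1 ≠ k := by
            intro h0
            rw [h0] at hv
            have := Fin.lt_def.1 h'
            omega
          simp [E, hk, h'.ne', this]
  rw [Matrix.det_mul, hE, mul_one] at hlast
  exact hlast

/-- Composition with a finite map does not increase the maximum, so `det (1 + x Φ) ≠ 0` for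
`‖x‖ < 1`. -/
theorem det_one_add_smul_compMatrix_ne_zero {ι : Type*} [Fintype ι] [DecidableEq ι]
    (σ : ι → ι) {x : ℂ} (hx : ‖x‖ < 1) : (1 + x • compMatrix ℂ σ).det ≠ 0 := by
  intro h
  obtain ⟨v, hv0, hv⟩ := Matrix.exists_mulVec_eq_zero_iff.2 h
  have hv' : ∀ i, v i = -(x * v (σ i)) := by
    intro i
    have := congrFun hv i
    rw [Matrix.add_mulVec, Matrix.smul_mulVec, compMatrix_mulVec] at this
    simp only [Matrix.one_mulVec, Pi.add_apply, Pi.smul_apply, Function.comp, smul_eq_mul,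
      Pi.zero_apply] at this
    exact eq_neg_of_add_eq_zero_left this
  apply hv0
  have : Nonempty ι := by
    by_contra hne
    rw [not_nonempty_iff] at hne
    exact hv0 (Subsingleton.elim _ _)
  obtain ⟨i, hi⟩ := Finite.exists_max fun i => ‖v i‖
  have h0 : ‖v i‖ = 0 := by
    have h1 : ‖v i‖ = ‖x‖ * ‖v (σ i)‖ := by
      conv_lhs => rw [hv' i]
      rw [norm_neg, norm_mul]
    have h2 := hi (σ i)
    have h3 := norm_nonneg (v i)
    have h4 := norm_nonneg x
    nlinarith
  ext j
  have := hi j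
  rw [h0] at this
  simpa using this

/-! ### Images of intervals and telescoping sums -/

/-- The image of an open interval under a continuous strictly decreasing function with prescribed
one-sided limits at the end points. -/
theorem StrictAntiOn.image_Ioo_eq {f : EReal → EReal} {x y l r : EReal} (hxy : x < y)
    (hf : StrictAntiOn f (Ioo x y)) (hc : ContinuousOn f (Ioo x y))
    (hl : Tendsto f (𝓝[<] y) (𝓝 l)) (hr : Tendsto f (𝓝[>] x) (𝓝 r)) :
    f '' Ioo x y = Ioo l r := by
  have : (𝓝[<] y).NeBot := nhdsLT_neBot_of_exists_lt ⟨x, hxy⟩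
  have : (𝓝[>] x).NeBot := nhdsGT_neBot_of_exists_gt ⟨y, hxy⟩
  apply Subset.antisymm
  · rintro _ ⟨u, hu, rfl⟩
    obtain ⟨v, hv1, hv2⟩ := exists_between hu.2
    obtain ⟨w, hw1, hw2⟩ := exists_between hu.1
    constructor
    · refine lt_of_le_of_lt (le_of_tendsto hl ?_) (hf hu ⟨hu.1.trans hv1, hv2⟩ hv1)
      filter_upwards [Ioo_mem_nhdsLT hv2] with s hs
      exact (hf ⟨hu.1.trans hv1, hv2⟩ ⟨(hu.1.trans hv1).trans hs.1, hs.2⟩ hs.1).le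
    · refine lt_of_lt_of_le (hf ⟨hw1, hw2.trans hu.2⟩ hu hw2) (ge_of_tendsto hr ?_)
      filter_upwards [Ioo_mem_nhdsGT hw1] with s hs
      exact (hf ⟨hs.1, hs.2.trans (hw2.trans hu.2)⟩ ⟨hw1, hw2.trans hu.2⟩ hs.2).le
  · exact isPreconnected_Ioo.intermediate_value_Ioo
      (le_principal_iff.2 (Ioo_mem_nhdsLT hxy)) (le_principal_iff.2 (Ioo_mem_nhdsGT hxy)) hc hl hr

theorem Fin.sum_succ_sub_castSucc {R : Type*} [AddCommGroup R] {n : ℕ} (g : Fin (n + 1) → R) :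
    ∑ i : Fin n, (g i.succ - g i.castSucc) = g (Fin.last n) - g 0 := by
  rw [Finset.sum_sub_distrib, ← add_sub_add_left_eq_sub _ _ (g 0), ← Fin.sum_univ_succ,
    add_comm (g 0), Fin.sum_univ_castSucc]
  abel

open Classical in
theorem Fin.sum_ite_succ_sub_castSucc {R : Type*} [Ring R] {n : ℕ} (g : Fin (n + 1) → R)
    {u v : Fin (n + 1)} (huv : u ≤ v) :
    ∑ j : Fin n, (if u ≤ j.castSucc ∧ j.succ ≤ v then 1 else 0) * (g j.succ - g j.castSucc) =
      g v - g u := by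
  -- Clamping the index to [u, v] kills the increments outside and keeps those inside.
  have h := Fin.sum_succ_sub_castSucc fun k => g (max u (min k v))
  simp only [min_eq_right (Fin.le_last v), min_eq_left (Fin.zero_le v), max_eq_right huv,
    max_eq_left (Fin.zero_le u)] at h
  rw [← h]
  refine Finset.sum_congr rfl fun j _ => ?_
  by_cases hu : u ≤ j.castSucc
  · have hu' : u ≤ j.succ := hu.trans j.castSucc_le_succ
    by_cases hv : j.succ ≤ v
    · have hv' : j.castSucc ≤ v := j.castSucc_le_succ.trans hv
      simp [hu, hv, hu', hv']
    · have hv' : v ≤ j.castSucc := by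
        rw [Fin.le_def]; rw [Fin.le_def] at hv; simp at hv ⊢; omega
      simp [hv, hv', hv'.trans j.castSucc_le_succ]
  · have hu' : j.succ ≤ u := by
      rw [Fin.le_def]; rw [Fin.le_def] at hu; simp at hu ⊢; omega
    have hu'' := j.castSucc_le_succ.trans hu'
    simp [hu, max_eq_left ((min_le_left _ v).trans hu'),
      max_eq_left ((min_le_left _ v).trans hu'')]

/-! ### Elementary properties of the map and of the side function -/

namespace OddBimodalMap

variable (F : OddBimodalMap)

theorem neg_c_lt_c : -F.c < F.c := (EReal.neg_lt_zero.2 F.c_pos).trans F.c_pos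

theorem neg_a_lt_neg_c : -F.a < -F.c := EReal.neg_lt_neg_iff.2 F.c_lt_a

theorem a_pos : 0 < F.a := F.c_pos.trans F.c_lt_a

theorem neg_a_lt_a : -F.a < F.a := (EReal.neg_lt_zero.2 F.a_pos).trans F.a_pos

theorem neg_mem_Icc {x : EReal} (hx : x ∈ Icc (-F.a) F.a) : -x ∈ Icc (-F.a) F.a :=
  ⟨EReal.neg_le_neg_iff.2 hx.2, EReal.neg_le.2 hx.1⟩

theorem c_mem_Icc : F.c ∈ Icc (-F.a) F.a :=
  ⟨(F.neg_a_lt_neg_c.trans F.neg_c_lt_c).le, F.c_lt_a.le⟩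

theorem a_mem_Icc : F.a ∈ Icc (-F.a) F.a := ⟨F.neg_a_lt_a.le, le_rfl⟩

/-- The bound on `b` is not postulated; it holds because `b` is a limit of values in `I`. -/
theorem b_mem_Icc : (F.b : EReal) ∈ Icc (-F.a) F.a := by
  have : (𝓝[<] F.a).NeBot := nhdsLT_neBot_of_exists_lt ⟨F.c, F.c_lt_a⟩
  refine isClosed_Icc.mem_of_tendsto F.tendsto_a ?_
  filter_upwards [Ioo_mem_nhdsLT F.c_lt_a] with x hx
  exact Ioo_subset_Icc_self (F.mapsTo x
    ⟨(F.neg_a_lt_neg_c.trans F.neg_c_lt_c).trans hx.1, hx.2⟩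
    (F.neg_c_lt_c.trans hx.1).ne' hx.1.ne')

theorem map_mem_Icc {x : EReal} (hx : x ∈ Icc (-F.a) F.a) : F.toFun x ∈ Icc (-F.a) F.a := by
  by_cases h1 : x = F.a
  · rw [h1, F.map_a]; exact F.b_mem_Icc
  by_cases h2 : x = -F.a
  · rw [h2, F.map_neg_a]; exact F.neg_mem_Icc F.b_mem_Icc
  by_cases h3 : x = -F.c
  · rw [h3, F.map_c1]; exact ⟨le_rfl, F.neg_a_lt_a.le⟩
  by_cases h4 : x = F.c
  · rw [h4, F.map_c2]; exact F.a_mem_Icc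
  exact Ioo_subset_Icc_self (F.mapsTo x
    ⟨lt_of_le_of_ne hx.1 (Ne.symm h2), lt_of_le_of_ne hx.2 h1⟩ h3 h4)

theorem iterate_mem_Icc {x : EReal} (hx : x ∈ Icc (-F.a) F.a) (k : ℕ) :
    F.toFun^[k] x ∈ Icc (-F.a) F.a := by
  induction k with
  | zero => exact hx
  | succ k ih => rw [Function.iterate_succ_apply']; exact F.map_mem_Icc ih

theorem iterate_neg {x : EReal} (hx : x ∈ Icc (-F.a) F.a) (k : ℕ) :
    F.toFun^[k] (-x) = -F.toFun^[k] x := by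
  induction k with
  | zero => rfl
  | succ k ih =>
    rw [Function.iterate_succ_apply', ih, F.odd _ (F.iterate_mem_Icc hx k),
      Function.iterate_succ_apply']

/-- The right limit of the map at a point of `[-a, a)`. -/
theorem tendsto_nhdsGT {x : EReal} (h1 : -F.a ≤ x) (h2 : x < F.a) :
    Tendsto F.toFun (𝓝[>] x) (𝓝 (if x = -F.c then F.a else F.toFun x)) := by
  split_ifs with h
  · rw [h]; exact F.tendsto_c1_right
  rcases h1.eq_or_lt with rfl | h1
  · rw [F.map_neg_a]; exact F.tendsto_neg_a
  rcases lt_or_gt_of_ne h with h | h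
  · exact (F.continuousOn_left.continuousAt (Ioo_mem_nhds h1 h)).continuousWithinAt
  rcases lt_trichotomy x F.c with h3 | rfl | h3
  · exact (F.continuousOn_mid.continuousAt (Ioo_mem_nhds h h3)).continuousWithinAt
  · rw [F.map_c2]; exact F.tendsto_c2_right
  · exact (F.continuousOn_right.continuousAt (Ioo_mem_nhds h3 h2)).continuousWithinAt

/-- The left limit of the map at a point of `(-a, a]`. -/
theorem tendsto_nhdsLT {x : EReal} (h1 : -F.a < x) (h2 : x ≤ F.a) :
    Tendsto F.toFun (𝓝[<] x) (𝓝 (if x = F.c then -F.a else F.toFun x)) := by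
  split_ifs with h
  · rw [h]; exact F.tendsto_c2_left
  rcases h2.eq_or_lt with rfl | h2
  · rw [F.map_a]; exact F.tendsto_a
  rcases lt_or_gt_of_ne h with h | h
  · rcases lt_trichotomy x (-F.c) with h3 | rfl | h3
    · exact (F.continuousOn_left.continuousAt (Ioo_mem_nhds h1 h3)).continuousWithinAt
    · rw [F.map_c1]; exact F.tendsto_c1_left
    · exact (F.continuousOn_mid.continuousAt (Ioo_mem_nhds h3 h)).continuousWithinAt
  · exact (F.continuousOn_right.continuousAt (Ioo_mem_nhds h h2)).continuousWithinAt

/-- The interval lies in one lap. The conventional values at the discontinuities are F(c₁⁻) and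
F(c₂⁺), so they differ from the limit taken inside the interval only if c₁ is its left end or c₂ its
right end. -/
theorem image_Ioo {x y : EReal} (hx : -F.a ≤ x) (hxy : x < y) (hy : y ≤ F.a)
    (h1 : -F.c ∉ Ioo x y) (h2 : F.c ∉ Ioo x y) :
    F.toFun '' Ioo x y =
      Ioo (if y = F.c then -F.a else F.toFun y) (if x = -F.c then F.a else F.toFun x) := by
  have key : ContinuousOn F.toFun (Ioo x y) ∧ StrictAntiOn F.toFun (Ioo x y) := by
    rcases lt_or_ge x (-F.c) with h | h
    · have hs : Ioo x y ⊆ Ioo (-F.a) (-F.c) :=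
        Ioo_subset_Ioo hx (not_lt.1 fun h' => h1 ⟨h, h'⟩)
      exact ⟨F.continuousOn_left.mono hs, F.anti_left.mono hs⟩
    rcases lt_or_ge x F.c with h' | h'
    · have hs : Ioo x y ⊆ Ioo (-F.c) F.c := Ioo_subset_Ioo h (not_lt.1 fun h'' => h2 ⟨h', h''⟩)
      exact ⟨F.continuousOn_mid.mono hs, F.anti_mid.mono hs⟩
    · have hs : Ioo x y ⊆ Ioo F.c F.a := Ioo_subset_Ioo h' hy
      exact ⟨F.continuousOn_right.mono hs, F.anti_right.mono hs⟩
  exact key.2.image_Ioo_eq hxy key.1 (F.tendsto_nhdsLT (hx.trans_lt hxy) hy)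
    (F.tendsto_nhdsGT hx (hxy.trans_le hy))

/-- The address as a number: `-1` on `[-a, c₁]`, `0` on `(c₁, c₂)` and `1` on `[c₂, a]`. -/
noncomputable def side (x : EReal) : ℝ := (F.address x).coord 2 - (F.address x).coord 0

theorem side_of_le {x : EReal} (h : x ≤ -F.c) : F.side x = -1 := by
  rcases h.lt_or_eq with h | h
  · simp [side, address, h, KSymbol.coord]
  · simp [side, address, h, KSymbol.coord]

theorem side_of_mid {x : EReal} (h1 : -F.c < x) (h2 : x < F.c) : F.side x = 0 := by
  simp [side, address, h1.not_gt, h1.ne', h2, KSymbol.coord]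

theorem side_of_ge {x : EReal} (h : F.c ≤ x) : F.side x = 1 := by
  have h1 := F.neg_c_lt_c.trans_le h
  rcases h.lt_or_eq with h | rfl
  · simp [side, address, h1.not_gt, h1.ne', h.not_gt, h.ne', KSymbol.coord]
  · simp [side, address, h1.not_gt, h1.ne', KSymbol.coord]

theorem abs_side_le (x : EReal) : |F.side x| ≤ 1 := by
  rcases le_or_gt x (-F.c) with h | h
  · simp [F.side_of_le h]
  rcases lt_or_ge x F.c with h' | h'
  · simp [F.side_of_mid h h']
  · simp [F.side_of_ge h']

theorem side_mono : Monotone F.side := by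
  intro x y h
  rcases le_or_gt x (-F.c) with h1 | h1
  · rw [F.side_of_le h1]; exact (abs_le.1 (F.abs_side_le y)).1
  rcases le_or_gt F.c y with h2 | h2
  · rw [F.side_of_ge h2]; exact (abs_le.1 (F.abs_side_le x)).2
  · rw [F.side_of_mid h1 (h.trans_lt h2), F.side_of_mid (h1.trans_le h) h2]

/-! ### Markov partitions and positivity of the path counts -/

/-- The points `z 0 < ⋯ < z n` form a Markov partition of `[-a, a]`, on which the map acts
through `σ`. -/
structure IsMarkovPartition {n : ℕ} (z : Fin (n + 1) → EReal) (σ : Fin (n + 1) → Fin (n + 1)) :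
    Prop where
  strictMono : StrictMono z
  map_eq : ∀ k, F.toFun (z k) = z (σ k)
  zero_eq : z 0 = -F.a
  last_eq : z (Fin.last n) = F.a
  exists_eq_c : ∃ k, z k = F.c
  exists_eq_neg_c : ∃ k, z k = -F.c

open Classical in
/-- The transition matrix of the partition with end points `z`. -/
noncomputable def transitionMatrix {n : ℕ} (z : Fin (n + 1) → EReal) : Matrix (Fin n) (Fin n) ℝ :=
  Matrix.of fun i j =>
    if Ioo (z j.castSucc) (z j.succ) ⊆ F.toFun '' Ioo (z i.castSucc) (z i.succ) then 1 else 0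

variable {F} {n : ℕ} {z : Fin (n + 1) → EReal} {σ : Fin (n + 1) → Fin (n + 1)}

theorem IsMarkovPartition.notMem_Ioo (h : F.IsMarkovPartition z σ) (k : Fin (n + 1)) (i : Fin n) :
    z k ∉ Ioo (z i.castSucc) (z i.succ) := by
  rintro ⟨h1, h2⟩
  have h1 := h.strictMono.lt_iff_lt.1 h1
  have h2 := h.strictMono.lt_iff_lt.1 h2
  rw [Fin.lt_def] at h1 h2
  simp at h1 h2
  omega

open Classical in
/-- The boundary of the image of a partition interval. -/
theorem IsMarkovPartition.sum_transitionMatrix (h : F.IsMarkovPartition z σ) {R : Type*}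
    [CommRing R] [Algebra ℝ R] (g : Fin (n + 1) → R) (i : Fin n) :
    ∑ j, (F.transitionMatrix z).map (algebraMap ℝ R) i j * (g j.succ - g j.castSucc) =
      (g (Fin.last n) - g 0) *
          (algebraMap ℝ R (F.side (z i.succ)) - algebraMap ℝ R (F.side (z i.castSucc))) -
        (g (σ i.succ) - g (σ i.castSucc)) := by
  have hc : F.c ∉ Ioo (z i.castSucc) (z i.succ) := by
    obtain ⟨k, hk⟩ := h.exists_eq_c
    rw [← hk]; exact h.notMem_Ioo k i
  have hc' : -F.c ∉ Ioo (z i.castSucc) (z i.succ) := by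
    obtain ⟨k, hk⟩ := h.exists_eq_neg_c
    rw [← hk]; exact h.notMem_Ioo k i
  have hlt : z i.castSucc < z i.succ := h.strictMono i.castSucc_lt_succ
  have hge : -F.a ≤ z i.castSucc := h.zero_eq ▸ h.strictMono.monotone (Fin.zero_le _)
  have hle : z i.succ ≤ F.a := h.last_eq ▸ h.strictMono.monotone (Fin.le_last _)
  let u : Fin (n + 1) := if z i.succ = F.c then 0 else σ i.succ
  let v : Fin (n + 1) := if z i.castSucc = -F.c then Fin.last n else σ i.castSucc
  have himg : F.toFun '' Ioo (z i.castSucc) (z i.succ) = Ioo (z u) (z v) := by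
    rw [F.image_Ioo hge hlt hle hc' hc]
    simp only [u, v, apply_ite z, h.zero_eq, h.last_eq, h.map_eq]
  have huv : u ≤ v := by
    have : (Ioo (z u) (z v)).Nonempty := by
      rw [← himg]; exact (nonempty_Ioo.2 hlt).image _
    exact (h.strictMono.lt_iff_lt.1 (nonempty_Ioo.1 this)).le
  have hψ : ∀ j, (F.transitionMatrix z).map (algebraMap ℝ R) i j =
      if u ≤ j.castSucc ∧ j.succ ≤ v then 1 else 0 := by
    intro j
    have : Ioo (z j.castSucc) (z j.succ) ⊆ Ioo (z u) (z v) ↔ u ≤ j.castSucc ∧ j.succ ≤ v := by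
      rw [Ioo_subset_Ioo_iff (h.strictMono j.castSucc_lt_succ), h.strictMono.le_iff_le,
        h.strictMono.le_iff_le]
    simp [transitionMatrix, himg, this, apply_ite (algebraMap ℝ R)]
  simp only [hψ]
  rw [Fin.sum_ite_succ_sub_castSucc g huv]
  have hσc : ∀ k, z k = F.c → σ k = Fin.last n := by
    intro k hk
    apply h.strictMono.injective
    rw [← h.map_eq, hk, F.map_c2, h.last_eq]
  have hσc' : ∀ k, z k = -F.c → σ k = 0 := by
    intro k hk
    apply h.strictMono.injective
    rw [← h.map_eq, hk, F.map_c1, h.zero_eq]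
  have hcc := F.neg_c_lt_c
  -- The increment of `side` counts the ends (c₁ on the left, c₂ on the right) where value and inner
  -- limit disagree. Each exchanges -a and a, which costs g_n - g_0.
  rcases lt_trichotomy (z i.castSucc) (-F.c) with hx | hx | hx
  · have hy : z i.succ ≤ -F.c := not_lt.1 fun h' => hc' ⟨hx, h'⟩
    have hy' : z i.succ ≠ F.c := (hy.trans_lt hcc).ne
    simp only [u, v, hx.ne, hy', if_false, F.side_of_le hx.le, F.side_of_le hy]
    ring
  · have hy : z i.succ ≤ F.c := not_lt.1 fun h' => hc ⟨hx ▸ hcc, h'⟩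
    rcases hy.lt_or_eq with hy | hy
    · simp only [u, v, hx, if_true, hy.ne, if_false, F.side_of_le le_rfl,
        F.side_of_mid (hx ▸ hlt) hy, hσc' _ hx, map_neg, map_one, map_zero]
      ring
    · simp only [u, v, hx, if_true, hy, F.side_of_le le_rfl,
        F.side_of_ge le_rfl, hσc' _ hx, hσc _ hy, map_neg, map_one]
      ring
  · rcases lt_or_ge (z i.castSucc) F.c with hx' | hx'
    · have hy : z i.succ ≤ F.c := not_lt.1 fun h' => hc ⟨hx', h'⟩
      rcases hy.lt_or_eq with hy | hy
      · simp only [u, v, hx.ne', hy.ne, if_false,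
          F.side_of_mid (hx.trans hlt) hy, F.side_of_mid hx hx', map_zero]
        ring
      · simp only [u, v, hx.ne', if_false, hy, if_true, F.side_of_ge le_rfl,
          F.side_of_mid hx hx', hσc _ hy, map_one, map_zero]
        ring
    · have hy := hx'.trans_lt hlt
      simp only [u, v, hx.ne', if_false, hy.ne', F.side_of_ge hy.le, F.side_of_ge hx', map_one]
      ring

theorem IsMarkovPartition.side_last (h : F.IsMarkovPartition z σ) :
    F.side (z (Fin.last n)) = 1 := by
  rw [h.last_eq, F.side_of_ge F.c_lt_a.le]

theorem IsMarkovPartition.side_zero (h : F.IsMarkovPartition z σ) : F.side (z 0) = -1 := by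
  rw [h.zero_eq, F.side_of_le F.neg_a_lt_neg_c.le]

theorem transitionMatrix_nonneg (i j : Fin n) : 0 ≤ F.transitionMatrix z i j := by
  classical
  simp only [transitionMatrix, Matrix.of_apply]
  split_ifs <;> norm_num

/-- Every interval of the partition is covered by the image of some interval. -/
theorem IsMarkovPartition.one_le_sum_transitionMatrix (h : F.IsMarkovPartition z σ) (j : Fin n) :
    1 ≤ ∑ i, F.transitionMatrix z i j := by
  -- A step function whose only increment is across the j-th interval, so it isolates column j.
  -- Summing over i gives 2 - (g(σ n) - g(σ 0)) ≥ 2 - 1.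
  let g : Fin (n + 1) → ℝ := fun k => if j.castSucc < k then 1 else 0
  have hg : ∀ k : Fin n, g k.succ - g k.castSucc = if k = j then 1 else 0 := by
    intro k
    simp only [g, Fin.lt_def, Fin.val_castSucc, Fin.val_succ, Fin.ext_iff]
    grind
  have hg1 : ∀ k, g k ≤ 1 := fun k => by simp only [g]; split_ifs <;> norm_num
  have hg0 : ∀ k, 0 ≤ g k := fun k => by simp only [g]; split_ifs <;> norm_num
  have hgl : g (Fin.last n) = 1 := by simp [g, Fin.castSucc_lt_last]
  have hgz : g 0 = 0 := by simp [g]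
  have h1 : ∀ i, F.transitionMatrix z i j =
      (F.side (z i.succ) - F.side (z i.castSucc)) - (g (σ i.succ) - g (σ i.castSucc)) := by
    intro i
    have := h.sum_transitionMatrix g i
    simpa [hg, hgl, hgz] using this
  have h2 := Fin.sum_succ_sub_castSucc fun k => F.side (z k)
  have h3 := Fin.sum_succ_sub_castSucc fun k => g (σ k)
  rw [Finset.sum_congr rfl fun i _ => h1 i, Finset.sum_sub_distrib, h2, h3, h.side_last,
    h.side_zero]
  have := hg1 (σ (Fin.last n))
  have := hg0 (σ 0)
  linarith

/-- The number of paths of length `k` to the discontinuities. -/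
theorem IsMarkovPartition.two_le_sum_pow_mulVec (h : F.IsMarkovPartition z σ) (k : ℕ) :
    2 ≤ ∑ i, (F.transitionMatrix z ^ k).mulVec
      (fun i => F.side (z i.succ) - F.side (z i.castSucc)) i := by
  have hη : ∀ i : Fin n, 0 ≤ F.side (z i.succ) - F.side (z i.castSucc) := fun i =>
    sub_nonneg.2 (F.side_mono (h.strictMono.monotone i.castSucc_le_succ))
  have hnn : ∀ (k : ℕ) (i j), 0 ≤ (F.transitionMatrix z ^ k) i j := by
    intro k
    induction k with
    | zero => intro i j; simp only [pow_zero, Matrix.one_apply]; split_ifs <;> norm_num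
    | succ k ih =>
      intro i j
      rw [pow_succ, Matrix.mul_apply]
      exact Finset.sum_nonneg fun l _ => mul_nonneg (ih i l) (transitionMatrix_nonneg l j)
  -- Column sums at least 1 pass to powers of a nonnegative matrix.
  have hcol : ∀ (k : ℕ) (j), 1 ≤ ∑ i, (F.transitionMatrix z ^ k) i j := by
    intro k
    induction k with
    | zero => intro j; simp [Matrix.one_apply]
    | succ k ih =>
      intro j
      simp only [pow_succ, Matrix.mul_apply]
      rw [Finset.sum_comm]
      simp only [← Finset.sum_mul]
      refine (h.one_le_sum_transitionMatrix j).trans (Finset.sum_le_sum fun l _ => ?_)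
      exact le_mul_of_one_le_left (transitionMatrix_nonneg l j) (ih l)
  have hsum := Fin.sum_succ_sub_castSucc fun k => F.side (z k)
  rw [h.side_last, h.side_zero] at hsum
  simp only [Matrix.mulVec, dotProduct]
  rw [Finset.sum_comm]
  simp only [← Finset.sum_mul]
  calc (2 : ℝ) = ∑ i : Fin n, (F.side (z i.succ) - F.side (z i.castSucc)) := by
        rw [hsum]; norm_num
    _ ≤ _ := Finset.sum_le_sum fun i _ => le_mul_of_one_le_left (hη i) (hcol k i)

end OddBimodalMap

/-! ### Zeros of power series whose reciprocal has nonnegative coefficients -/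

theorem continuousOn_tsum_mul_pow_closedBall {u : ℕ → ℂ} {r : ℝ}
    (h : Summable fun k => ‖u k‖ * r ^ k) :
    ContinuousOn (fun z : ℂ => ∑' k, u k * z ^ k) (Metric.closedBall 0 r) := by
  refine continuousOn_tsum (fun k => by fun_prop) h fun k z hz => ?_
  rw [norm_mul, norm_pow]
  have : ‖z‖ ≤ r := by simpa using hz
  gcongr

/-- Linear growth is allowed because division by 1 + t turns the bounded coefficients of N into
linearly growing ones for D. -/
theorem summable_mul_pow_of_abs_le {u : ℕ → ℝ} {K : ℝ} (hu : ∀ k, |u k| ≤ K * (k + 1)) {r : ℝ}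
    (h0 : 0 ≤ r) (h1 : r < 1) : Summable fun k => |u k| * r ^ k := by
  have hs : Summable fun k : ℕ => K * ((k : ℝ) * r ^ k + r ^ k) := by
    refine Summable.mul_left _ (Summable.add ?_ (summable_geometric_of_lt_one h0 h1))
    simpa using summable_pow_mul_geometric_of_norm_lt_one 1
      (show ‖r‖ < 1 by rwa [Real.norm_of_nonneg h0])
  refine Summable.of_nonneg_of_le (fun k => by positivity) (fun k => ?_) hs
  calc |u k| * r ^ k ≤ K * (k + 1) * r ^ k := by gcongr; exact hu k
    _ = _ := by ring

theorem continuousAt_tsum_mul_pow {u : ℕ → ℝ} {K : ℝ} (hu : ∀ k, |u k| ≤ K * (k + 1)) {z : ℂ}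
    (hz : ‖z‖ < 1) : ContinuousAt (fun z : ℂ => ∑' k, (u k : ℂ) * z ^ k) z := by
  obtain ⟨r, h1, h2⟩ := exists_between hz
  have h0 : 0 ≤ r := (norm_nonneg z).trans h1.le
  refine (continuousOn_tsum_mul_pow_closedBall (r := r) ?_).continuousAt
    (Metric.closedBall_mem_nhds_of_mem (by simpa using h1))
  simpa using summable_mul_pow_of_abs_le hu h0 h2

/-- If `f (1 + z ∑ A_k z^k) = 1` inside the disc of radius `r`, where `A_k ≥ 0`, and `f` has a
zero on its boundary, then `f r = 0`. -/
theorem eq_zero_of_mul_eq_one_of_nonneg {f : ℂ → ℂ} {A : ℕ → ℝ} {r : ℝ} (hr : 0 < r)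
    (hf : ∀ z : ℂ, ‖z‖ = r → ContinuousAt f z) (hA : ∀ k, 0 ≤ A k)
    (hsum : ∀ t, 0 ≤ t → t < r → Summable fun k => A k * t ^ k)
    (hmul : ∀ z : ℂ, ‖z‖ < r → f z * (1 + z * ∑' k, (A k : ℂ) * z ^ k) = 1)
    {z₀ : ℂ} (hz₀ : ‖z₀‖ = r) (hfz : f z₀ = 0) : f r = 0 := by
  by_contra hne
  have hrn : ‖(r : ℂ)‖ = r := by simp [abs_of_pos hr]
  have hpos : 0 < ‖f r‖ := norm_pos_iff.2 hne
  have hev : ∀ᶠ t : ℝ in 𝓝[<] r, ‖f r‖ / 2 < ‖f t‖ := by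
    have h1 : Tendsto (fun t : ℝ => ‖f t‖) (𝓝 r) (𝓝 ‖f r‖) :=
      ((hf r hrn).tendsto.comp (Complex.continuous_ofReal.tendsto r)).norm
    exact (h1.mono_left nhdsWithin_le_nhds).eventually (lt_mem_nhds (half_lt_self hpos))
  -- For t close to r the partial sums, having nonnegative terms, are at most 1/‖f t‖ < 2/‖f r‖; let
  -- t tend to r. Thus f r ≠ 0 would make the series converge at r, hence absolutely on the circle.
  have hbound : ∀ K : ℕ, r * ∑ k ∈ Finset.range K, A k * r ^ k ≤ 2 / ‖f r‖ := by
    intro K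
    have hcont : Tendsto (fun t : ℝ => t * ∑ k ∈ Finset.range K, A k * t ^ k) (𝓝[<] r)
        (𝓝 (r * ∑ k ∈ Finset.range K, A k * r ^ k)) := by
      have : Continuous fun t : ℝ => t * ∑ k ∈ Finset.range K, A k * t ^ k := by fun_prop
      exact (this.tendsto r).mono_left nhdsWithin_le_nhds
    refine le_of_tendsto hcont ?_
    filter_upwards [hev, Ioo_mem_nhdsLT hr] with t ht htr
    have hs := hsum t htr.1.le htr.2
    have hT : ((∑' k, A k * t ^ k : ℝ) : ℂ) = ∑' k, (A k : ℂ) * (t : ℂ) ^ k := by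
      rw [Complex.ofReal_tsum]; simp
    have h0 : 0 ≤ ∑' k, A k * t ^ k :=
      tsum_nonneg fun k => mul_nonneg (hA k) (pow_nonneg htr.1.le k)
    have hm := congrArg norm (hmul t (by simpa [abs_of_pos htr.1] using htr.2))
    rw [← hT, norm_mul, norm_one] at hm
    have hn : ‖(1 : ℂ) + t * ((∑' k, A k * t ^ k : ℝ) : ℂ)‖ = 1 + t * ∑' k, A k * t ^ k := by
      rw [← Complex.ofReal_one, ← Complex.ofReal_mul, ← Complex.ofReal_add, Complex.norm_real,
        Real.norm_of_nonneg (add_nonneg zero_le_one (mul_nonneg htr.1.le h0))]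
    rw [hn] at hm
    have hle : ∑ k ∈ Finset.range K, A k * t ^ k ≤ ∑' k, A k * t ^ k :=
      hs.sum_le_tsum _ fun k _ => mul_nonneg (hA k) (pow_nonneg htr.1.le k)
    have h3 : t * ∑ k ∈ Finset.range K, A k * t ^ k ≤ t * ∑' k, A k * t ^ k :=
      mul_le_mul_of_nonneg_left hle htr.1.le
    have h4 : 0 ≤ t * ∑' k, A k * t ^ k := mul_nonneg htr.1.le h0
    rw [le_div_iff₀ hpos]
    nlinarith
  have hsr : Summable fun k => A k * r ^ k := by
    refine summable_of_sum_range_le (c := 2 / ‖f r‖ / r)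
      (fun k => mul_nonneg (hA k) (pow_nonneg hr.le k)) fun K => ?_
    rw [le_div_iff₀ hr, mul_comm]
    exact hbound K
  have hg : ContinuousOn (fun z : ℂ => ∑' k, (A k : ℂ) * z ^ k) (Metric.closedBall 0 r) := by
    refine continuousOn_tsum_mul_pow_closedBall ?_
    simpa [abs_of_nonneg (hA _)] using hsr
  have hmem : ∀ᶠ s : ℝ in 𝓝[<] 1, s ∈ Ioo (0 : ℝ) 1 := Ioo_mem_nhdsLT one_pos
  have hnorm : ∀ s : ℝ, s ∈ Ioo (0 : ℝ) 1 → ‖(s : ℂ) * z₀‖ < r := by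
    intro s hs
    rw [norm_mul, hz₀, Complex.norm_real, Real.norm_of_nonneg hs.1.le]
    nlinarith [hs.2]
  have hlim : Tendsto (fun s : ℝ => (s : ℂ) * z₀) (𝓝[<] 1) (𝓝 z₀) := by
    have : Continuous fun s : ℝ => (s : ℂ) * z₀ := by fun_prop
    simpa using (this.tendsto 1).mono_left (nhdsWithin_le_nhds (s := Iio 1))
  have hlimW : Tendsto (fun s : ℝ => (s : ℂ) * z₀) (𝓝[<] 1) (𝓝[Metric.closedBall 0 r] z₀) :=
    tendsto_nhdsWithin_iff.2 ⟨hlim, hmem.mono fun s hs => by simpa using (hnorm s hs).le⟩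
  have hz₀b : z₀ ∈ Metric.closedBall (0 : ℂ) r := by simp [hz₀]
  -- The radial limit of the product at z₀ is 0 times a finite number, yet the product is constantly
  -- 1.
  have h1 := ((hf z₀ hz₀).tendsto.comp hlim).mul
    ((hlim.mul ((hg z₀ hz₀b).tendsto.comp hlimW)).const_add 1)
  rw [hfz, zero_mul] at h1
  have h2 := h1.congr' (hmem.mono fun s hs => hmul _ (hnorm s hs))
  exact one_ne_zero (tendsto_nhds_unique tendsto_const_nhds h2)

/-- The least root of `D` when `N = D (1 + X)` is the reciprocal of `1 + z ∑ A_k z^k` with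
`A_k ≥ 1`, inside the disc of radius `1 / ρ`. -/
theorem isLeast_isUnitIntervalRoot {D : PowerSeries ℝ} {u A : ℕ → ℝ} {ρ : ℝ}
    (hDu : ∀ k, PowerSeries.coeff k (D * (1 + PowerSeries.X)) = u k)
    (hu : ∀ k, |u k| ≤ 2) (hA : ∀ k, 1 ≤ A k)
    (hsum : ∀ t, 0 ≤ t → t * ρ < 1 → Summable fun k => A k * t ^ k)
    (hmul : ∀ z : ℂ, ‖z‖ < 1 → ‖z‖ * ρ < 1 →
      (∑' k, (u k : ℂ) * z ^ k) * (1 + z * ∑' k, (A k : ℂ) * z ^ k) = 1)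
    (hz : 1 < ρ → ∃ z : ℂ, ‖z‖ = 1 / ρ ∧ ∑' k, (u k : ℂ) * z ^ k = 0) :
    IsLeast {t | IsUnitIntervalRoot D t} (1 / ρ) := by
  have hρ1 : 1 ≤ ρ := by
    -- If ρ < 1, the series would converge at 1 although its terms are at least 1.
    by_contra hlt
    have hs := hsum 1 zero_le_one (by linarith)
    have := ge_of_tendsto hs.tendsto_atTop_zero (Eventually.of_forall fun k => by simpa using hA k)
    linarith
  have hρ0 : 0 < ρ := by linarith
  have ht1 : 1 / ρ ≤ 1 := by rw [div_le_one hρ0]; exact hρ1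
  have ht0 : 0 < 1 / ρ := by positivity
  let d : ℕ → ℝ := fun k => PowerSeries.coeff k D
  have hd0 : d 0 = u 0 := by rw [← hDu]; simp [d]
  have hdS : ∀ k, d (k + 1) + d k = u (k + 1) := by
    intro k; rw [← hDu, mul_add, mul_one, map_add, PowerSeries.coeff_succ_mul_X]
  have hd : ∀ k, |d k| ≤ 2 * (k + 1) := by
    intro k
    induction k with
    | zero => simpa [hd0] using hu 0
    | succ k ih =>
      have h1 : d (k + 1) = u (k + 1) - d k := by rw [← hdS]; ring
      have h2 := abs_sub (u (k + 1)) (d k)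
      have h3 := hu (k + 1)
      rw [h1]; push_cast; linarith
  have hu' : ∀ k, |u k| ≤ 2 * (k + 1) := fun k => (hu k).trans (by
    have : (0 : ℝ) ≤ k := k.cast_nonneg
    linarith)
  let f : ℂ → ℂ := fun z => ∑' k, (u k : ℂ) * z ^ k
  let e : ℝ → ℝ := fun t => ∑' k, d k * t ^ k
  have hdsum : ∀ t ∈ Ico (0 : ℝ) 1, Summable fun k => d k * t ^ k := by
    intro t ht
    have := summable_mul_pow_of_abs_le hd ht.1 ht.2
    refine Summable.of_abs (this.congr fun k => ?_)
    rw [abs_mul, abs_of_nonneg (pow_nonneg ht.1 k)]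
  have hfe : ∀ t ∈ Ico (0 : ℝ) 1, f t = (((1 + t) * e t : ℝ) : ℂ) := by
    intro t ht
    have hs := hdsum t ht
    have hus : Summable fun k => u k * t ^ k := by
      have := summable_mul_pow_of_abs_le hu' ht.1 ht.2
      refine Summable.of_abs (this.congr fun k => ?_)
      rw [abs_mul, abs_of_nonneg (pow_nonneg ht.1 k)]
    have h1 : f t = ((∑' k, u k * t ^ k : ℝ) : ℂ) := by
      rw [Complex.ofReal_tsum]; simp [f]
    rw [h1, hus.tsum_eq_zero_add]
    congr 1
    have h2 : e t = d 0 * t ^ 0 + ∑' k, d (k + 1) * t ^ (k + 1) := hs.tsum_eq_zero_add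
    have h3 : t * e t = ∑' k, d k * t ^ (k + 1) := by
      rw [← tsum_mul_left]
      exact tsum_congr fun k => by ring
    have hs1 : Summable fun k => d (k + 1) * t ^ (k + 1) := (summable_nat_add_iff 1).2 hs
    have hs2 : Summable fun k => d k * t ^ (k + 1) :=
      (hs.mul_left t).congr fun k => by ring
    rw [add_mul, one_mul, h3, h2, add_assoc, ← hs1.tsum_add hs2, hd0]
    congr 1
    exact tsum_congr fun k => by rw [← hdS]; ring
  have hec : ∀ t ∈ Ioo (0 : ℝ) 1, ContinuousAt e t := by
    intro t ht
    have h1 : ContinuousAt (fun s : ℝ => (f s).re / (1 + s)) t := by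
      have hft : ContinuousAt f (t : ℂ) :=
        continuousAt_tsum_mul_pow hu' (by simpa [abs_of_pos ht.1] using ht.2)
      have h2 : ContinuousAt (fun s : ℝ => (f s).re) t :=
        Complex.continuous_re.continuousAt.comp
          (ContinuousAt.comp (f := fun s : ℝ => (s : ℂ)) hft Complex.continuous_ofReal.continuousAt)
      exact h2.div (by fun_prop) (by linarith [ht.1])
    refine h1.congr ?_
    filter_upwards [Ioo_mem_nhds ht.1 ht.2] with s hs
    rw [hfe s ⟨hs.1.le, hs.2⟩, Complex.ofReal_re, mul_div_cancel_left₀]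
    linarith [hs.1]
  have hprod : ∀ t, 0 ≤ t → t < 1 / ρ → (1 + t) * e t * (1 + t * ∑' k, A k * t ^ k) = 1 := by
    intro t h0 h1
    have hm := hmul t (by simpa [abs_of_nonneg h0] using h1.trans_le ht1)
      (by simpa [abs_of_nonneg h0] using (lt_div_iff₀ hρ0).1 h1)
    have hT : ((∑' k, A k * t ^ k : ℝ) : ℂ) = ∑' k, (A k : ℂ) * (t : ℂ) ^ k := by
      rw [Complex.ofReal_tsum]; simp
    rw [← hT] at hm
    change f t * _ = 1 at hm
    rw [hfe t ⟨h0, h1.trans_le ht1⟩] at hm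
    exact_mod_cast hm
  constructor
  · refine ⟨ht0, ht1, fun s hs => hdsum s ⟨hs.1, hs.2.trans_le ht1⟩, ?_⟩
    change Tendsto e _ _
    rcases hρ1.eq_or_lt with hρe | hρl
    · rw [← hρe, div_one]
      have hlim : Tendsto (fun t : ℝ => 1 - t) (𝓝[<] 1) (𝓝 0) := by
        have : Continuous fun t : ℝ => 1 - t := by fun_prop
        simpa using (this.tendsto 1).mono_left (nhdsWithin_le_nhds (s := Iio 1))
      have hmem : ∀ᶠ s : ℝ in 𝓝[<] 1, s ∈ Ioo (0 : ℝ) 1 := Ioo_mem_nhdsLT one_pos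
      -- For ρ = 1 continuity at the end point is not available. Instead ∑ A_k t^k ≥ 1/(1 - t) gives
      -- (1 + t)D(t) ≤ 1 - t.
      have key : ∀ t ∈ Ioo (0 : ℝ) 1, 0 ≤ e t ∧ e t ≤ 1 - t := by
        intro t ht
        have hp := hprod t ht.1.le (by rw [← hρe, div_one]; exact ht.2)
        have hg : (1 - t)⁻¹ ≤ ∑' k, A k * t ^ k := by
          rw [← tsum_geometric_of_lt_one ht.1.le ht.2]
          refine Summable.tsum_le_tsum (fun k => ?_) (summable_geometric_of_lt_one ht.1.le ht.2)
            (hsum t ht.1.le (by rw [← hρe, mul_one]; exact ht.2))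
          exact le_mul_of_one_le_left (pow_nonneg ht.1.le k) (hA k)
        have h1t : 0 < 1 - t := by linarith [ht.2]
        have hge : (1 - t)⁻¹ ≤ 1 + t * ∑' k, A k * t ^ k := by
          have h1 : t * (1 - t)⁻¹ ≤ t * ∑' k, A k * t ^ k :=
            mul_le_mul_of_nonneg_left hg ht.1.le
          have h2 : 1 + t * (1 - t)⁻¹ = (1 - t)⁻¹ := by field_simp; ring
          linarith
        have hB : 0 < 1 + t * ∑' k, A k * t ^ k := (inv_pos.2 h1t).trans_le hge
        have he : 0 ≤ e t := by
          by_contra hneg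
          have : (1 + t) * e t < 0 := mul_neg_of_pos_of_neg (by linarith [ht.1]) (not_le.1 hneg)
          nlinarith
        refine ⟨he, ?_⟩
        have h3 : e t ≤ (1 + t) * e t := by nlinarith [ht.1]
        have h4 : (1 + t) * e t * (1 - t)⁻¹ ≤ 1 :=
          (mul_le_mul_of_nonneg_left hge (h3.trans' he)).trans_eq hp
        rw [← div_eq_mul_inv, div_le_one h1t] at h4
        exact h3.trans h4
      exact squeeze_zero' (hmem.mono fun t ht => (key t ht).1)
        (hmem.mono fun t ht => (key t ht).2) hlim
    · have hlt : 1 / ρ < 1 := by rw [div_lt_one hρ0]; exact hρl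
      obtain ⟨z₀, hz₀, hfz⟩ := hz hρl
      have h0 : f ((1 / ρ : ℝ) : ℂ) = 0 := by
        refine eq_zero_of_mul_eq_one_of_nonneg (f := f) (A := A) ht0
          (fun z hz => continuousAt_tsum_mul_pow hu' (hz ▸ hlt))
          (fun k => zero_le_one.trans (hA k))
          (fun t h0 h1 => hsum t h0 ((lt_div_iff₀ hρ0).1 h1))
          (fun z h1 => hmul z (h1.trans hlt) ((lt_div_iff₀ hρ0).1 h1)) hz₀ hfz
      rw [hfe _ ⟨ht0.le, hlt⟩] at h0
      have h0 : (1 + 1 / ρ) * e (1 / ρ) = 0 := by exact_mod_cast h0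
      have h0 : e (1 / ρ) = 0 := (mul_eq_zero.1 h0).resolve_left (by positivity)
      have := (hec _ ⟨ht0, hlt⟩).tendsto
      rw [h0] at this
      exact this.mono_left nhdsWithin_le_nhds
  · rintro t ⟨h0, -, -, hlim⟩
    by_contra hlt
    rw [not_le] at hlt
    have h1 := (hec t ⟨h0, hlt.trans_le ht1⟩).tendsto.mono_left (nhdsWithin_le_nhds (s := Iio t))
    have h2 : e t = 0 := tendsto_nhds_unique h1 hlim
    have := hprod t h0.le hlt
    simp [h2] at this

/-! ### Spectral radius and Neumann series -/

-- The resolvent z ↦ (1 - za)⁻¹ is holomorphic in the disc of radius 1/ρ(a), so its Taylor series ∑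
-- a^k z^k converges absolutely there.
open scoped ENNReal NNReal in
theorem summable_norm_pow_mul_pow_of_lt_inv_spectralRadius {A : Type*} [NormedRing A]
    [NormedAlgebra ℂ A] [CompleteSpace A] (a : A) {r : ℝ≥0} (hr : r < (spectralRadius ℂ a)⁻¹) :
    Summable fun k => ‖a ^ k‖ * (r : ℝ) ^ k := by
  obtain ⟨s, h1, h2⟩ := ENNReal.lt_iff_exists_nnreal_btwn.1 hr
  have h1 : r < s := by exact_mod_cast h1
  let P : FormalMultilinearSeries ℂ ℂ A :=
    fun n => ContinuousMultilinearMap.mkPiRing ℂ (Fin n) (a ^ n)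
  have hP : (s : ℝ≥0∞) ≤ P.radius :=
    ((spectrum.hasFPowerSeriesOnBall_inverse_one_sub_smul ℂ a).exchange_radius
      ((spectrum.differentiableOn_inverse_one_sub_smul h2).hasFPowerSeriesOnBall
        (pos_of_gt h1))).r_le
  have := P.summable_norm_mul_pow (lt_of_lt_of_le (by exact_mod_cast h1) hP)
  simpa [P, ContinuousMultilinearMap.norm_mkPiRing] using this

open scoped Matrix.Norms.Operator in
theorem Matrix.spectralRadius_ne_top {ι : Type*} [Fintype ι] [DecidableEq ι]
    (M : Matrix ι ι ℂ) : spectralRadius ℂ M ≠ ⊤ := by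
  rcases isEmpty_or_nonempty ι with hι | hι
  · simp [spectrum.SpectralRadius.of_subsingleton]
  · exact ne_top_of_le_ne_top ENNReal.coe_ne_top (spectrum.spectralRadius_le_nnnorm M)

open scoped Matrix.Norms.Operator in
/-- The Neumann series of a complex matrix. -/
theorem Matrix.exists_inverse_one_sub_smul {ι : Type*} [Fintype ι] [DecidableEq ι]
    (M : Matrix ι ι ℂ) {z : ℂ} (hz : ‖z‖ * (spectralRadius ℂ M).toReal < 1) :
    ∃ G : Matrix ι ι ℂ, G * (1 - z • M) = 1 ∧ ∀ η : ι → ℂ,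
      HasSum (fun k => (∑ i, (M ^ k).mulVec η i) * z ^ k) (∑ i, G.mulVec η i) := by
  have hfin : spectralRadius ℂ M ≠ ⊤ := M.spectralRadius_ne_top
  have hlt : (‖z‖₊ : ENNReal) < (spectralRadius ℂ M)⁻¹ := by
    rw [ENNReal.lt_inv_iff_lt_inv, ← ENNReal.ofReal_toReal hfin]
    rcases eq_or_ne z 0 with rfl | h0
    · simp
    · have hp : 0 < ‖z‖₊ := by simpa using h0
      rw [← ENNReal.coe_inv hp.ne', ← ENNReal.ofReal_coe_nnreal,
        ENNReal.ofReal_lt_ofReal_iff (by positivity), NNReal.coe_inv, coe_nnnorm,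
        ← one_div, lt_div_iff₀ (by simpa using h0), mul_comm]
      exact hz
  have hs : Summable fun k => (z • M) ^ k := by
    refine Summable.of_norm ((summable_norm_pow_mul_pow_of_lt_inv_spectralRadius M hlt).congr
      fun k => ?_)
    rw [smul_pow, norm_smul, norm_pow z k, mul_comm, coe_nnnorm]
  refine ⟨∑' k, (z • M) ^ k, hs.tsum_pow_mul_one_sub, fun η => ?_⟩
  let ℓ : Matrix ι ι ℂ →ₗ[ℂ] ℂ :=
    { toFun := fun X => ∑ i, X.mulVec η i
      map_add' := fun X Y => by simp [Matrix.add_mulVec, Finset.sum_add_distrib]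
      map_smul' := fun c X => by simp [Matrix.smul_mulVec, Finset.mul_sum] }
  have := hs.hasSum.mapL (LinearMap.toContinuousLinearMap ℓ)
  refine HasSum.congr_fun this fun k => ?_
  simp [ℓ, smul_pow, mul_comm]

-- The zero is the reciprocal of an eigenvalue of maximal modulus. Its argument is not controlled
-- here; nonnegativity of the A_k later replaces it by a positive zero.
open scoped Matrix.Norms.Operator in
theorem Matrix.exists_det_one_sub_smul_eq_zero {ι : Type*} [Fintype ι] [DecidableEq ι]
    [Nonempty ι] (M : Matrix ι ι ℂ) (h : 0 < (spectralRadius ℂ M).toReal) :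
    ∃ z : ℂ, ‖z‖ = 1 / (spectralRadius ℂ M).toReal ∧ (1 - z • M).det = 0 := by
  obtain ⟨l, hl, hn⟩ := spectrum.exists_nnnorm_eq_spectralRadius M
  have hn' : ‖l‖ = (spectralRadius ℂ M).toReal := by rw [← hn]; simp
  have hl0 : l ≠ 0 := by
    rintro rfl
    rw [norm_zero] at hn'
    exact h.ne hn'
  refine ⟨l⁻¹, by rw [norm_inv, hn', one_div], ?_⟩
  rw [spectrum.mem_iff, Matrix.isUnit_iff_isUnit_det, isUnit_iff_ne_zero, not_not] at hl
  have : algebraMap ℂ (Matrix ι ι ℂ) l - M = l • (1 - l⁻¹ • M) := by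
    rw [smul_sub, smul_smul, mul_inv_cancel₀ hl0, one_smul, Algebra.algebraMap_eq_smul_one]
  rw [this, Matrix.det_smul] at hl
  exact (mul_eq_zero.1 hl).resolve_left (pow_ne_zero _ hl0)

/-! ### The kneading determinant in terms of the side function -/

namespace OddBimodalMap

/-- Reading A as L and B as R respects the reflection, which exchanges the closed outer laps. -/
theorem coord_address_neg (F : OddBimodalMap) (x : EReal) :
    (F.address (-x)).coord 0 = (F.address x).coord 2 ∧
    (F.address (-x)).coord 1 = (F.address x).coord 1 ∧
    (F.address (-x)).coord 2 = (F.address x).coord 0 := by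
  have hc := F.neg_c_lt_c
  rcases lt_trichotomy x (-F.c) with h | rfl | h
  · have h' : F.c < -x := EReal.lt_neg_comm.1 h
    have h'' := hc.trans h'
    simp [address, h, h'.not_gt, h'.ne', h''.not_gt, h''.ne', KSymbol.coord]
  · simp [address, hc.ne', hc.not_gt, KSymbol.coord]
  rcases lt_trichotomy x F.c with h' | rfl | h'
  · have h1 : -F.c < -x := EReal.neg_lt_neg_iff.2 h'
    have h2 : -x < F.c := EReal.neg_lt_comm.1 h
    simp [address, h.not_gt, h.ne', h', h1.not_gt, h1.ne', h2, KSymbol.coord]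
  · simp [address, hc.ne', hc.not_gt, KSymbol.coord]
  · have h1 : -x < -F.c := EReal.neg_lt_neg_iff.2 h'
    simp [address, h.not_gt, h.ne', h'.not_gt, h'.ne', h1, KSymbol.coord]

/-- The difference of the `R` and `L` coordinates of the invariant coordinate of a point. -/
noncomputable def sideSeries (F : OddBimodalMap) (x : EReal) : PowerSeries ℝ :=
  PowerSeries.mk fun k => (-1) ^ k * F.side (F.toFun^[k] x)

theorem invariantCoord_consWord (s : KSymbol) (X : ℕ → KSymbol) (j : Fin 3) :
    invariantCoord (consWord s X) j =
      PowerSeries.C (s.coord j) - PowerSeries.X * invariantCoord X j := by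
  ext k
  rcases k with - | k
  · simp [invariantCoord, consWord]
  · simp [invariantCoord, consWord, PowerSeries.coeff_succ_X_mul, pow_succ]

/-- By oddness θ_{-a} is θ_a with L and R exchanged, so with y the R minus the L coordinate of θ_a
the rows are (-1 + ty, 1, -ty) and (ty, -1, 1 - ty). They sum to zero, and all minors equal 1 - 2ty
up to sign. -/
theorem kneadingDet_mul (F : OddBimodalMap) (j : Fin 3) :
    F.kneadingDet j * (1 + PowerSeries.X) =
      1 - PowerSeries.X * (F.sideSeries F.a - F.sideSeries (-F.a)) := by
  have h0 : invariantCoord (F.itinerary (-F.a)) 0 = invariantCoord (F.itinerary F.a) 2 := by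
    ext k
    simp [invariantCoord, itinerary, F.iterate_neg F.a_mem_Icc, (F.coord_address_neg _).1]
  have h1 : invariantCoord (F.itinerary (-F.a)) 1 = invariantCoord (F.itinerary F.a) 1 := by
    ext k
    simp [invariantCoord, itinerary, F.iterate_neg F.a_mem_Icc, (F.coord_address_neg _).2.1]
  have h2 : invariantCoord (F.itinerary (-F.a)) 2 = invariantCoord (F.itinerary F.a) 0 := by
    ext k
    simp [invariantCoord, itinerary, F.iterate_neg F.a_mem_Icc, (F.coord_address_neg _).2.2]
  have hY : ∀ x, F.sideSeries x =
      invariantCoord (F.itinerary x) 2 - invariantCoord (F.itinerary x) 0 := by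
    intro x
    ext k
    simp [sideSeries, invariantCoord, itinerary, side, mul_sub]
  have hinv : (1 + PowerSeries.X : PowerSeries ℝ)⁻¹ * (1 + PowerSeries.X) = 1 :=
    PowerSeries.inv_mul_cancel _ (by simp)
  rw [kneadingDet, mul_assoc, hinv, mul_one, Matrix.det_fin_two, hY, hY, h0, h2]
  fin_cases j <;>
  simp [kneadingMatrix, itineraryLeft, itineraryRight, invariantCoord_consWord, KSymbol.coord,
      Fin.succAbove, h0, h1, h2] <;> ring

/-! ### The Markov partition of a periodic kneading sequence -/

theorem IsPeriodicKneading.iterate_c {F : OddBimodalMap} {p : ℕ} (hp : F.IsPeriodicKneading p) :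
    F.toFun^[p] F.c = F.c := by
  have := Function.isPeriodicPt_minimalPeriod F.toFun F.c
  rw [hp.2] at this
  exact this

theorem IsPeriodicKneading.iterate_neg_c {F : OddBimodalMap} {p : ℕ}
    (hp : F.IsPeriodicKneading p) : F.toFun^[p] (-F.c) = -F.c := by
  rw [F.iterate_neg F.c_mem_Icc, hp.iterate_c]

theorem IsPeriodicKneading.mem_markovPoints {F : OddBimodalMap} {p : ℕ}
    (hp : F.IsPeriodicKneading p) {x : EReal} : x ∈ F.markovPoints p ↔
      (∃ k, F.toFun^[k] F.c = x) ∨ ∃ k, F.toFun^[k] (-F.c) = x := by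
  have h : ∀ {y : EReal}, F.toFun^[p] y = y →
      ((∃ k, k < p ∧ F.toFun^[k] y = x) ↔ ∃ k, F.toFun^[k] y = x) := by
    intro y hy
    refine ⟨fun ⟨k, _, hk⟩ => ⟨k, hk⟩, fun ⟨k, hk⟩ => ⟨k % p, Nat.mod_lt _ hp.1, ?_⟩⟩
    rw [Function.IsPeriodicPt.iterate_mod_apply hy, hk]
  simp only [markovPoints, Finset.mem_union, Finset.mem_image, Finset.mem_range]
  rw [h hp.iterate_c, h hp.iterate_neg_c]

theorem IsPeriodicKneading.mem_Icc {F : OddBimodalMap} {p : ℕ}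
    (hp : F.IsPeriodicKneading p) {x : EReal} (hx : x ∈ F.markovPoints p) :
    x ∈ Icc (-F.a) F.a := by
  rcases hp.mem_markovPoints.1 hx with ⟨k, rfl⟩ | ⟨k, rfl⟩
  · exact F.iterate_mem_Icc F.c_mem_Icc k
  · exact F.iterate_mem_Icc (F.neg_mem_Icc F.c_mem_Icc) k

theorem IsPeriodicKneading.map_mem {F : OddBimodalMap} {p : ℕ}
    (hp : F.IsPeriodicKneading p) {x : EReal} (hx : x ∈ F.markovPoints p) :
    F.toFun x ∈ F.markovPoints p := by
  rw [hp.mem_markovPoints] at hx ⊢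
  rcases hx with ⟨k, rfl⟩ | ⟨k, rfl⟩
  · exact Or.inl ⟨k + 1, Function.iterate_succ_apply' _ _ _⟩
  · exact Or.inr ⟨k + 1, Function.iterate_succ_apply' _ _ _⟩

theorem IsPeriodicKneading.card_markovPoints {F : OddBimodalMap} {p : ℕ}
    (hp : F.IsPeriodicKneading p) : (F.markovPoints p).card = F.numIntervals p + 1 := by
  have : 0 < (F.markovPoints p).card :=
    Finset.card_pos.2 ⟨F.c, hp.mem_markovPoints.2 (Or.inl ⟨0, rfl⟩)⟩
  unfold numIntervals
  omega

/-- The points of the Markov partition, indexed by `Fin (numIntervals + 1)`. -/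
noncomputable def IsPeriodicKneading.point {F : OddBimodalMap} {p : ℕ}
    (hp : F.IsPeriodicKneading p) (k : Fin (F.numIntervals p + 1)) : EReal :=
  F.markovPoint p ⟨k, by rw [hp.card_markovPoints]; exact k.2⟩

theorem IsPeriodicKneading.point_mem {F : OddBimodalMap} {p : ℕ}
    (hp : F.IsPeriodicKneading p) (k) : hp.point k ∈ F.markovPoints p :=
  Finset.orderEmbOfFin_mem _ _ _

theorem IsPeriodicKneading.exists_point_eq {F : OddBimodalMap} {p : ℕ}
    (hp : F.IsPeriodicKneading p) {x : EReal} (hx : x ∈ F.markovPoints p) :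
    ∃ k, hp.point k = x := by
  have : x ∈ Set.range ((F.markovPoints p).orderEmbOfFin rfl) := by
    rw [Finset.range_orderEmbOfFin]; exact hx
  obtain ⟨k, hk⟩ := this
  exact ⟨⟨k, by rw [← hp.card_markovPoints]; exact k.2⟩, hk⟩

/-- The point set is invariant, and it reaches both end points since F(c₁) = -a and F(c₂) = a. -/
theorem IsPeriodicKneading.exists_isMarkovPartition {F : OddBimodalMap} {p : ℕ}
    (hp : F.IsPeriodicKneading p) : ∃ σ, F.IsMarkovPartition hp.point σ := by
  choose σ hσ using fun k => hp.exists_point_eq (hp.map_mem (hp.point_mem k))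
  have hmono : StrictMono hp.point := fun i j hij =>
    ((F.markovPoints p).orderEmbOfFin rfl).strictMono hij
  have hc : F.c ∈ F.markovPoints p := hp.mem_markovPoints.2 (Or.inl ⟨0, rfl⟩)
  have hc' : -F.c ∈ F.markovPoints p := hp.mem_markovPoints.2 (Or.inr ⟨0, rfl⟩)
  refine ⟨σ, hmono, fun k => (hσ k).symm, ?_, ?_, hp.exists_point_eq hc, hp.exists_point_eq hc'⟩
  · obtain ⟨k, hk⟩ := hp.exists_point_eq (hp.map_mem hc')
    rw [F.map_c1] at hk
    exact le_antisymm (hk ▸ hmono.monotone (Fin.zero_le k)) (hp.mem_Icc (hp.point_mem 0)).1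
  · obtain ⟨k, hk⟩ := hp.exists_point_eq (hp.map_mem hc)
    rw [F.map_c2] at hk
    exact le_antisymm (hp.mem_Icc (hp.point_mem _)).2 (hk ▸ hmono.monotone (Fin.le_last k))

theorem IsPeriodicKneading.markovMatrix_eq {F : OddBimodalMap} {p : ℕ}
    (hp : F.IsPeriodicKneading p) : F.markovMatrix p = F.transitionMatrix hp.point := by
  ext i j
  rfl

/-! ### Kneading determinant and transition matrix -/

variable {F : OddBimodalMap} {n : ℕ} {z : Fin (n + 1) → EReal} {σ : Fin (n + 1) → Fin (n + 1)}

theorem IsMarkovPartition.iterate_succ (h : F.IsMarkovPartition z σ) (i : Fin (n + 1)) (k : ℕ) :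
    F.toFun^[k + 1] (z i) = F.toFun^[k] (z (σ i)) := by
  rw [Function.iterate_succ_apply, h.map_eq]

/-- This is the equation y = δ - t(y ∘ σ); the sign comes from the alternating weights (-1)^k. -/
theorem IsMarkovPartition.sideSeries_eq (h : F.IsMarkovPartition z σ) (i : Fin (n + 1)) :
    F.sideSeries (z i) = algebraMap ℝ (PowerSeries ℝ) (F.side (z i)) -
      PowerSeries.X * F.sideSeries (z (σ i)) := by
  ext k
  rcases k with - | k
  · simp [sideSeries]
  · simp [sideSeries, PowerSeries.coeff_succ_X_mul, pow_succ, h.map_eq]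

/-- The determinant identity for the Markov partition, as an identity of power series. -/
theorem IsMarkovPartition.det_mul_kneadingDet (h : F.IsMarkovPartition z σ) (j : Fin 3) :
    (1 - (PowerSeries.X : PowerSeries ℝ) •
        (F.transitionMatrix z).map (algebraMap ℝ (PowerSeries ℝ))).det =
      (1 + (PowerSeries.X : PowerSeries ℝ) • compMatrix (PowerSeries ℝ) σ).det *
        F.kneadingDet j := by
  have key := det_transition_eq σ (fun i => algebraMap ℝ (PowerSeries ℝ) (F.side (z i))) _
    (fun g i => h.sum_transitionMatrix g i) PowerSeries.X (fun i => F.sideSeries (z i))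
    h.sideSeries_eq
  rw [h.last_eq, h.zero_eq, ← F.kneadingDet_mul j] at key
  have hne : (1 + PowerSeries.X : PowerSeries ℝ) ≠ 0 := by
    intro h0
    simpa using congrArg PowerSeries.constantCoeff h0
  apply mul_left_cancel₀ hne
  rw [key]
  ring

/-- The values of `sideSeries` on the unit disc. -/
noncomputable def sideSum (F : OddBimodalMap) (w : ℂ) (x : EReal) : ℂ :=
  ∑' k, (F.side (F.toFun^[k] x) : ℂ) * (-w) ^ k

theorem summable_sideSum (F : OddBimodalMap) {w : ℂ} (hw : ‖w‖ < 1) (x : EReal) :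
    Summable fun k => (F.side (F.toFun^[k] x) : ℂ) * (-w) ^ k := by
  refine Summable.of_norm_bounded (summable_geometric_of_lt_one (norm_nonneg w) hw) fun k => ?_
  rw [norm_mul, norm_pow, norm_neg, Complex.norm_real]
  exact mul_le_of_le_one_left (by positivity) (F.abs_side_le _)

theorem IsMarkovPartition.sideSum_eq (h : F.IsMarkovPartition z σ) {w : ℂ} (hw : ‖w‖ < 1)
    (i : Fin (n + 1)) :
    F.sideSum w (z i) = algebraMap ℝ ℂ (F.side (z i)) - w * F.sideSum w (z (σ i)) := by
  unfold sideSum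
  rw [(F.summable_sideSum hw (z i)).tsum_eq_zero_add, ← tsum_mul_left, sub_eq_add_neg, ← tsum_neg]
  congr 1
  · simp
  · exact tsum_congr fun k => by rw [h.iterate_succ, pow_succ]; ring

theorem tsum_coeff_kneadingDet_mul (F : OddBimodalMap) (j : Fin 3) {w : ℂ} (hw : ‖w‖ < 1) :
    ∑' k, ((PowerSeries.coeff k (F.kneadingDet j * (1 + PowerSeries.X)) : ℝ) : ℂ) * w ^ k =
      1 - w * (F.sideSum w F.a - F.sideSum w (-F.a)) := by
  have h1 := F.summable_sideSum hw F.a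
  have h2 := F.summable_sideSum hw (-F.a)
  have hs := ((h1.sub h2).mul_left (-w))
  have hcoeff : ∀ k, ((PowerSeries.coeff (k + 1)
      (F.kneadingDet j * (1 + PowerSeries.X)) : ℝ) : ℂ) * w ^ (k + 1) =
      -w * ((F.side (F.toFun^[k] F.a) : ℂ) * (-w) ^ k -
        (F.side (F.toFun^[k] (-F.a)) : ℂ) * (-w) ^ k) := by
    intro k
    rw [kneadingDet_mul, map_sub, PowerSeries.coeff_succ_X_mul]
    simp only [PowerSeries.coeff_one, sideSeries, map_sub, PowerSeries.coeff_mk]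
    push_cast
    rw [neg_pow w]
    simp
    ring
  rw [Summable.tsum_eq_zero_add ((summable_nat_add_iff 1).1 (by simpa only [hcoeff] using hs))]
  simp only [hcoeff, tsum_mul_left, h1.tsum_sub h2]
  rw [kneadingDet_mul]
  simp [sideSum]
  ring

theorem abs_coeff_kneadingDet_mul_le (F : OddBimodalMap) (j : Fin 3) (k : ℕ) :
    |PowerSeries.coeff k (F.kneadingDet j * (1 + PowerSeries.X))| ≤ 2 := by
  rw [kneadingDet_mul]
  rcases k with - | k
  · simp
  · rw [map_sub, PowerSeries.coeff_succ_X_mul]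
    simp only [PowerSeries.coeff_one, sideSeries, map_sub, PowerSeries.coeff_mk]
    rw [← mul_sub, if_neg (Nat.succ_ne_zero k), zero_sub, abs_neg, abs_mul, abs_neg_one_pow,
      one_mul]
    have h1 := F.abs_side_le (F.toFun^[k] F.a)
    have h2 := F.abs_side_le (F.toFun^[k] (-F.a))
    exact (abs_sub _ _).trans (by linarith)

/-- The least root of the kneading determinant is the reciprocal of the spectral radius. -/
theorem IsMarkovPartition.isLeast_root (h : F.IsMarkovPartition z σ) (j : Fin 3) :
    IsLeast {t | IsUnitIntervalRoot (F.kneadingDet j) t}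
      (1 / (spectralRadius ℂ ((F.transitionMatrix z).map (algebraMap ℝ ℂ))).toReal) := by
  set M := (F.transitionMatrix z).map (algebraMap ℝ ℂ) with hM
  set ρ := (spectralRadius ℂ M).toReal with hρ
  let A : ℕ → ℝ := fun k => ∑ i, (F.transitionMatrix z ^ k).mulVec
      (fun i => F.side (z i.succ) - F.side (z i.castSucc)) i
  let η : Fin n → ℂ := fun i => algebraMap ℝ ℂ (F.side (z i.succ)) -
    algebraMap ℝ ℂ (F.side (z i.castSucc))
  have hA : ∀ k, ((A k : ℝ) : ℂ) = ∑ i, (M ^ k).mulVec η i := by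
    intro k
    rw [hM, ← Matrix.map_pow]
    simp [A, η, Matrix.mulVec, dotProduct]
  have hne : Nonempty (Fin n) := by
    rcases n with - | n
    · exfalso
      have h1 := h.zero_eq
      have h2 := h.last_eq
      rw [show Fin.last 0 = 0 from rfl, h1] at h2
      exact F.neg_a_lt_a.ne h2
    · exact ⟨0⟩
  refine isLeast_isUnitIntervalRoot (A := A) (fun k => rfl) (F.abs_coeff_kneadingDet_mul_le j)
    (fun k => one_le_two.trans (h.two_le_sum_pow_mulVec k)) ?_ ?_ ?_
  · intro t h0 ht
    obtain ⟨G, -, hG⟩ := M.exists_inverse_one_sub_smul (z := (t : ℂ))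
      (by rwa [Complex.norm_real, Real.norm_of_nonneg h0])
    have := (hG η).summable
    simp only [← hA] at this
    exact_mod_cast this
  · intro w hw hwρ
    obtain ⟨G, hG1, hG⟩ := M.exists_inverse_one_sub_smul hwρ
    have hsum := (hG η).tsum_eq
    simp only [← hA] at hsum
    rw [tsum_coeff_kneadingDet_mul F j hw, hsum]
    have key := kneading_mul_eq_one σ (fun i => algebraMap ℝ ℂ (F.side (z i))) M
      (fun g i => h.sum_transitionMatrix g i) w (fun i => F.sideSum w (z i))
      (h.sideSum_eq hw) G hG1
    rwa [h.last_eq, h.zero_eq] at key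
  -- Here |w| = 1/ρ < 1, so det(1 + wC) ≠ 0 and the zero of det(1 - wΨ) must come from N.
  · intro hρ1
    obtain ⟨w, hw, hdet⟩ := M.exists_det_one_sub_smul_eq_zero (by linarith)
    have hw1 : ‖w‖ < 1 := by rw [hw, div_lt_one (by linarith)]; exact hρ1
    refine ⟨w, hw, ?_⟩
    have key := det_transition_eq σ (fun i => algebraMap ℝ ℂ (F.side (z i))) M
      (fun g i => h.sum_transitionMatrix g i) w (fun i => F.sideSum w (z i))
      (h.sideSum_eq hw1)
    rw [hdet, mul_zero, h.last_eq, h.zero_eq] at key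
    rw [tsum_coeff_kneadingDet_mul F j hw1]
    exact (mul_eq_zero.1 key.symm).resolve_left (det_one_add_smul_compMatrix_ne_zero σ hw1)

/-- If the orbit of `a` does not contain `-a`, the orbits of `c₁` and `c₂` are two disjoint
cycles. -/
theorem IsPeriodicKneading.det_one_add_smul_compMatrix {q : ℕ}
    (hp : F.IsPeriodicKneading (q + 1)) (hb : ¬ F.IsBistable)
    {σ : Fin (F.numIntervals (q + 1) + 1) → Fin (F.numIntervals (q + 1) + 1)}
    (h : F.IsMarkovPartition hp.point σ) {R : Type*} [CommRing R] (x : R) :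
    (1 + x • compMatrix R σ).det = (1 - (-x) ^ (q + 1)) ^ 2 := by
  choose e₁ he₁ using fun k : Fin (q + 1) =>
    hp.exists_point_eq (hp.mem_markovPoints.2 (Or.inl ⟨k, rfl⟩))
  choose e₂ he₂ using fun k : Fin (q + 1) =>
    hp.exists_point_eq (hp.mem_markovPoints.2 (Or.inr ⟨k, rfl⟩))
  have hinj : ∀ k l : Fin (q + 1), F.toFun^[k] F.c = F.toFun^[l] F.c → k = l := by
    intro k l hkl
    have hk : (k : ℕ) < Function.minimalPeriod F.toFun F.c := k.2.trans_eq hp.2.symm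
    have hl : (l : ℕ) < Function.minimalPeriod F.toFun F.c := l.2.trans_eq hp.2.symm
    exact Fin.ext ((Function.iterate_eq_iterate_iff_of_lt_minimalPeriod hk hl).1 hkl)
  have hdisj : ∀ k l : Fin (q + 1), F.toFun^[k] F.c ≠ F.toFun^[l] (-F.c) := by
    intro k l hkl
    apply hb
    -- If F^k(c₂) = F^l(c₁), then q + 1 - l further steps complete the period of c₁, and one more
    -- step leads to -a; the first step from c₂ led to a.
    refine ⟨q + 1 - l + k, ?_⟩
    conv_lhs => rw [← F.map_c2]
    rw [← F.map_c1, ← Function.iterate_succ_apply, Function.iterate_succ_apply',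
      Function.iterate_add_apply, hkl, ← Function.iterate_add_apply,
      Nat.sub_add_cancel l.2.le, hp.iterate_neg_c]
  have hbij : Function.Bijective (Sum.elim e₁ e₂) := by
    constructor
    · rintro (k | k) (l | l) hkl <;> simp only [Sum.elim_inl, Sum.elim_inr] at hkl <;>
        have hkl := congrArg hp.point hkl
      · rw [he₁, he₁] at hkl
        rw [hinj k l hkl]
      · rw [he₁, he₂] at hkl
        exact absurd hkl (hdisj k l)
      · rw [he₁, he₂] at hkl
        exact absurd hkl.symm (hdisj l k)
      · rw [he₂, he₂, F.iterate_neg F.c_mem_Icc, F.iterate_neg F.c_mem_Icc, neg_inj] at hkl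
        rw [hinj k l hkl]
    · intro m
      have hm := hp.point_mem m
      simp only [markovPoints, Finset.mem_union, Finset.mem_image, Finset.mem_range] at hm
      rcases hm with ⟨k, hk, hkm⟩ | ⟨k, hk, hkm⟩
      · exact ⟨Sum.inl ⟨k, hk⟩, h.strictMono.injective ((he₁ ⟨k, hk⟩).trans hkm)⟩
      · exact ⟨Sum.inr ⟨k, hk⟩, h.strictMono.injective ((he₂ ⟨k, hk⟩).trans hkm)⟩
  have hadd : ∀ {y : EReal}, F.toFun^[q + 1] y = y → ∀ k : Fin (q + 1),
      F.toFun^[((k + 1 : Fin (q + 1)) : ℕ)] y = F.toFun (F.toFun^[k] y) := by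
    intro y hy k
    rw [Fin.val_add_one]
    split_ifs with hk
    · rw [hk, Function.iterate_zero, id, Fin.val_last, ← Function.iterate_succ_apply' F.toFun, hy]
    · rw [Function.iterate_succ_apply']
  have hσ₁ : ∀ k, σ (e₁ k) = e₁ (k + 1) := by
    intro k
    apply h.strictMono.injective
    rw [← h.map_eq, he₁, he₁, hadd hp.iterate_c]
  have hσ₂ : ∀ k, σ (e₂ k) = e₂ (k + 1) := by
    intro k
    apply h.strictMono.injective
    rw [← h.map_eq, he₂, he₂, hadd hp.iterate_neg_c]
  let e := Equiv.ofBijective _ hbij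
  -- Relabelling the points by their times along the two orbits turns σ into two copies of the
  -- cyclic shift.
  have he : (1 + x • compMatrix R σ).submatrix e e = Matrix.fromBlocks
      (1 + x • compMatrix R fun i : Fin (q + 1) => i + 1) 0 0
      (1 + x • compMatrix R fun i : Fin (q + 1) => i + 1) := by
    have h11 : ∀ k l, e₁ k = e₁ l ↔ k = l := fun k l =>
      ⟨fun hkl => Sum.inl_injective (hbij.1 hkl), fun hkl => hkl ▸ rfl⟩
    have h22 : ∀ k l, e₂ k = e₂ l ↔ k = l := fun k l =>
      ⟨fun hkl => Sum.inr_injective (hbij.1 hkl), fun hkl => hkl ▸ rfl⟩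
    have h12 : ∀ k l, e₁ k ≠ e₂ l := fun k l hkl => by
      have := @hbij.1 (Sum.inl k) (Sum.inr l) hkl
      simp at this
    ext (k | k) (l | l) <;>
      simp [e, compMatrix, Matrix.one_apply, hσ₁, hσ₂, h11, h22, h12, (h12 _ _).symm]
  rw [← Matrix.det_submatrix_equiv_self e, he, Matrix.det_fromBlocks_zero₂₁,
    det_one_add_smul_cycle, sq]

end OddBimodalMap

theorem mainTheorem3 (F : OddBimodalMap) (p : ℕ) (hp : F.IsPeriodicKneading p) (j : Fin 3) :
    (∃ t₀ : ℝ, IsLeast {t : ℝ | IsUnitIntervalRoot (F.kneadingDet j) t} t₀ ∧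
      spectralRadius ℂ ((F.markovMatrix p).map (algebraMap ℝ ℂ)) = ENNReal.ofReal (1 / t₀)) ∧
    (¬ F.IsBistable →
      (1 - (-1) ^ p * PowerSeries.X ^ p) ^ 2 * F.kneadingDet j =
        (1 - (PowerSeries.X : PowerSeries ℝ) •
          (F.markovMatrix p).map (PowerSeries.C : ℝ →+* PowerSeries ℝ)).det) := by
  obtain ⟨σ, h⟩ := hp.exists_isMarkovPartition
  rw [hp.markovMatrix_eq]
  refine ⟨⟨_, h.isLeast_root j, ?_⟩, fun hb => ?_⟩
  · rw [one_div_one_div, ENNReal.ofReal_toReal (Matrix.spectralRadius_ne_top _)]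
  · obtain ⟨q, rfl⟩ : ∃ q, p = q + 1 := ⟨p - 1, by have := hp.1; omega⟩
    rw [← neg_pow, ← hp.det_one_add_smul_compMatrix hb h]
    exact (h.det_mul_kneadingDet j).symm
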